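/- All manifolds, metrics and connections are smooth, metrics are positive definite, and $M$ is a (finite-dimensional, Hausdorff) manifold without boundary. A \emph{statistical manifold} $(M,g_M,D)$ is a manifold with a Riemannian metric $g_M$ and a torsion-free affine connection $D$ such that the 3-tensor $Dg_M$ is totally symmetric; it is \emph{of constant curvature} $c$ if $\Theta_D(X,Y)Z=c\,(g_M(Y,Z)X-g_M(X,Z)Y)$ for all $X,Y,Z$, where $\Theta_D$ is the curvature of $D$. A \emph{Hessian manifold} $(C,\nabla,g)$ is a manifold with a flat torsion-free connection $\nabla$ and a Riemannian metric $g$ which is locally of the form $g=\mathrm{Hess}\,\varphi=\nabla d\varphi$ for a smooth function $\varphi$. A \emph{Hessian cone} is a Hessian manifold $(M\times\mathbb R^{>0},\nabla,g=s^2g_M+ds^2)$, where $s$ is the coordinate on $\mathbb R^{>0}$ and $g_M$ is a Riemannian metric on $M$, such that for some constant $\lambda\neq 0,\tfrac12$ the vector field $\rho=\lambda s\frac{\partial}{\partial s}$ is radiant, i.e. $\nabla\rho=\mathrm{Id}$. Vector fields $X,Y$ on $M$ are also regarded as vector fields on $M\times\mathbb R^{>0}$ that are tangent to the slices $M\times\{s\}$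 and do not depend on $s$. \textbf{Theorem.} (1) Let $(M\times\mathbb R^{>0},\nabla,g=s^2g_M+ds^2)$ be a Hessian cone with radiant vector field $\rho=\lambda s\frac{\partial}{\partial s}$, and let $c=\frac{2\lambda-1}{\lambda^2}$. Then there is a torsion-free connection $D$ on $M$ such that for all vector fields $X,Y$ on $M$ $$\nabla_XY=D_XY-c\,g_M(X,Y)\,\rho\qquad(\ast)$$ on $M\times\mathbb R^{>0}$, in particular along $M=M\times\{1\}$. Moreover, $(M,g_M,D)$ is a statistical manifold of constant curvature $c$. (2) Conversely, let $(M,g_M,D)$ be a statistical manifold of constant curvature $c$ with $c\neq 0$ and $c\le 1$. Then the equation $\frac{2\lambda-1}{\lambda^2}=c$ has a real solution $\lambda$. For every real solution $\lambda$, with $\rho=\lambda s\frac{\partial}{\partial s}$, the formula $(\ast)$ together with $$\nabla_X\rho=\nabla_\rho X=X,\qquad \nabla_\rho\rho=\rho$$ for vector fields $X$ on $M$ defines a connection $\nabla$ on $M\times\mathbb R^{>0}$, and $(M\times\mathbb R^{>0},\nabla,g=s^2g_M+ds^2)$ is a Hessian cone with radiant vector field $\rho$. -/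

import Mathlib

open Bundle
open scoped Manifold ContDiff

noncomputable section

namespace HessianCone

section General

variable {E : Type*} [NormedAddCommGroup E] [NormedSpace ℝ E]
  {H : Type*} [TopologicalSpace H] {I : ModelWithCorners ℝ E H}
  {M : Type*} [TopologicalSpace M] [ChartedSpace H M] [IsManifold I ∞ M]

variable (I M) in
/-- Affine connections on `M` (Koszul connections on the tangent bundle).
Note the argument order of Mathlib: `nabla Y x v` is `(∇_v Y)(x)`. -/
abbrev AffineConnection : Type _ :=
  CovariantDerivative I E (TangentSpace I : M → Type _)

variable (I M) in
/-- Smooth (positive definite) Riemannian metrics on `M`. -/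
abbrev SmoothMetric : Type _ :=
  ContMDiffRiemannianMetric I ∞ E (TangentSpace I : M → Type _)

/-- `Y` is a smooth vector field on `M`. -/
def SmoothField (Y : Π x : M, TangentSpace I x) : Prop :=
  ContMDiff I I.tangent ∞ (fun x ↦ (⟨x, Y x⟩ : TangentBundle I M))

/-- The vector field `Y` is differentiable at the point `x`. -/
def DiffFieldAt (Y : Π x : M, TangentSpace I x) (x : M) : Prop :=
  MDifferentiableAt I I.tangent (fun y ↦ (⟨y, Y y⟩ : TangentBundle I M)) x

/-- The connection is torsion-free: `∇_X Y - ∇_Y X = [X, Y]`. -/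
def IsTorsionFree (nabla : AffineConnection I M) : Prop :=
  ∀ X Y : Π x : M, TangentSpace I x, SmoothField X → SmoothField Y →
    ∀ x, nabla Y x (X x) - nabla X x (Y x) = VectorField.mlieBracket I X Y x

/-- `Θ_∇(X, Y) Z = ∇_X ∇_Y Z - ∇_Y ∇_X Z - ∇_[X, Y] Z`. -/
def curvature (nabla : AffineConnection I M) (X Y Z : Π x : M, TangentSpace I x) (x : M) :
    TangentSpace I x :=
  nabla (fun y ↦ nabla Z y (Y y)) x (X x) - nabla (fun y ↦ nabla Z y (X y)) x (Y x)
    - nabla Z x (VectorField.mlieBracket I X Y x)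

/-- The connection is flat: its curvature vanishes. -/
def IsFlat (nabla : AffineConnection I M) : Prop :=
  ∀ X Y Z : Π x : M, TangentSpace I x, SmoothField X → SmoothField Y → SmoothField Z →
    ∀ x, curvature nabla X Y Z x = 0

/-- The Hessian `∇dφ` at `x`, in the form `(v, Y) ↦ v(Y φ) - (∇_v Y) φ`. In local coordinates in
which the Christoffel symbols of `∇` vanish, this is `∑ (∂²φ/∂xⁱ∂xʲ) vⁱ Yʲ`. -/
def hess (nabla : AffineConnection I M) (phi : M → ℝ) (Y : Π x : M, TangentSpace I x) (x : M)
    (v : TangentSpace I x) : ℝ :=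
  mvfderiv I (fun y ↦ mvfderiv I phi y (Y y)) x v - mvfderiv I phi x (nabla Y x v)

/-- `(∇_X g)(Y, Z) = X(g(Y, Z)) - g(∇_X Y, Z) - g(Y, ∇_X Z)`. -/
def covDerivMetric (nabla : AffineConnection I M) (g : SmoothMetric I M)
    (X Y Z : Π x : M, TangentSpace I x) (x : M) : ℝ :=
  mvfderiv I (fun y ↦ g.inner y (Y y) (Z y)) x (X x)
    - g.inner x (nabla Y x (X x)) (Z x) - g.inner x (Y x) (nabla Z x (X x))

/-- The metric `g` is, near every point, the Hessian of a smooth function. -/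
def IsHessianMetric (nabla : AffineConnection I M) (g : SmoothMetric I M) : Prop :=
  ∀ x₀ : M, ∃ U : Set M, IsOpen U ∧ x₀ ∈ U ∧ ∃ phi : M → ℝ, ContMDiffOn I 𝓘(ℝ) ∞ phi U ∧
    ∀ x ∈ U, ∀ (v : TangentSpace I x) (Y : Π x : M, TangentSpace I x), DiffFieldAt Y x →
      g.inner x v (Y x) = hess nabla phi Y x v

/-- A flat affine manifold: the smooth connection `nabla` is flat and torsion-free. -/
structure IsFlatAffine (nabla : AffineConnection I M) : Prop where
  smooth : CovariantDerivative.ContMDiffCovariantDerivative nabla ∞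
  torsion_free : IsTorsionFree nabla
  flat : IsFlat nabla

/-- A Hessian manifold: a flat affine manifold with a Hessian Riemannian metric. -/
structure IsHessianManifold (nabla : AffineConnection I M) (g : SmoothMetric I M) : Prop where
  flat_affine : IsFlatAffine nabla
  hessian : IsHessianMetric nabla g

/-- A radiant manifold: a flat affine manifold with a vector field `rho` such that `∇ rho = Id`. -/
structure IsRadiant (nabla : AffineConnection I M) (rho : Π x : M, TangentSpace I x) : Prop where
  flat_affine : IsFlatAffine nabla
  smooth_field : SmoothField rho
  nabla_rho : ∀ (x : M) (v : TangentSpace I x), nabla rho x v = v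

/-- A statistical manifold: a smooth torsion-free connection `D` and a Riemannian metric `g` such
that the 3-tensor `D g` is totally symmetric. -/
structure IsStatistical (D : AffineConnection I M) (g : SmoothMetric I M) : Prop where
  smooth : CovariantDerivative.ContMDiffCovariantDerivative D ∞
  torsion_free : IsTorsionFree D
  symm_left : ∀ X Y Z : Π x : M, TangentSpace I x,
    SmoothField X → SmoothField Y → SmoothField Z →
      ∀ x, covDerivMetric D g X Y Z x = covDerivMetric D g Y X Z x
  symm_right : ∀ X Y Z : Π x : M, TangentSpace I x,
    SmoothField X → SmoothField Y → SmoothField Z →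
      ∀ x, covDerivMetric D g X Y Z x = covDerivMetric D g X Z Y x

/-- A statistical manifold of constant curvature `c`:
`Θ_D(X, Y) Z = c (g(Y, Z) X - g(X, Z) Y)`. -/
structure IsStatisticalOfConstCurvature (D : AffineConnection I M) (g : SmoothMetric I M) (c : ℝ) :
    Prop where
  statistical : IsStatistical D g
  curvature_eq : ∀ X Y Z : Π x : M, TangentSpace I x,
    SmoothField X → SmoothField Y → SmoothField Z →
      ∀ x, curvature D X Y Z x = c • (g.inner x (Y x) (Z x) • X x - g.inner x (X x) (Z x) • Y x)

end General

/-- The half-line `ℝ^{>0}`, an open submanifold of `ℝ`. -/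
abbrev PosReal : TopologicalSpace.Opens ℝ := ⟨Set.Ioi 0, isOpen_Ioi⟩

/-- The manifold `M × ℝ^{>0}`. -/
abbrev Cone (M : Type*) : Type _ := M × PosReal

section ConeGeometry

variable {E : Type*} [NormedAddCommGroup E] [NormedSpace ℝ E]
  {H : Type*} [TopologicalSpace H]

/-- The model with corners of the product manifold `M × ℝ^{>0}`. -/
abbrev coneModel (I : ModelWithCorners ℝ E H) :
    ModelWithCorners ℝ (E × ℝ) (ModelProd H ℝ) := I.prod 𝓘(ℝ)

variable {I : ModelWithCorners ℝ E H}
  {M : Type*} [TopologicalSpace M] [ChartedSpace H M] [IsManifold I ∞ M]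

/-- The component in `T_x M` of a tangent vector to `M × ℝ^{>0}` at `p = (x, s)`: the differential
of the projection to `M`. -/
def basePart (p : Cone M) (w : TangentSpace (coneModel I) p) : TangentSpace I p.1 :=
  mfderiv (coneModel I) I (Prod.fst : Cone M → M) p w

/-- The component `ds(w)` of a tangent vector `w` to `M × ℝ^{>0}` at `p = (x, s)`. -/
def dsPart (p : Cone M) (w : TangentSpace (coneModel I) p) : ℝ :=
  mvfderiv (coneModel I) (fun q : Cone M ↦ (q.2 : ℝ)) p w

/-- A vector `v` in `T_x M`, regarded as a vector tangent to the slice `M × {s}` at `p = (x, s)`. -/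
def horVec (p : Cone M) (v : TangentSpace I p.1) : TangentSpace (coneModel I) p :=
  ((v, 0) : E × ℝ)

/-- A vector field `Y` on `M`, regarded as a vector field on `M × ℝ^{>0}` tangent to the slices
`M × {s}` and independent of `s`. -/
def lift (Y : Π x : M, TangentSpace I x) (p : Cone M) : TangentSpace (coneModel I) p :=
  horVec p (Y p.1)

/-- The vector field `λ s ∂/∂s` on `M × ℝ^{>0}`. -/
def radialField (lam : ℝ) (p : Cone M) : TangentSpace (coneModel I) p :=
  ((0, lam * (p.2 : ℝ)) : E × ℝ)

/-- The Riemannian metric `g` on `M × ℝ^{>0}` is `s² g_M + ds²`. -/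
def IsConeMetric (gM : SmoothMetric I M) (g : SmoothMetric (coneModel I) (Cone M)) : Prop :=
  ∀ (p : Cone M) (w w' : TangentSpace (coneModel I) p),
    g.inner p w w' = (p.2 : ℝ) ^ 2 * gM.inner p.1 (basePart p w) (basePart p w')
      + dsPart p w * dsPart p w'

/-- A Hessian cone: a Hessian manifold `(M × ℝ^{>0}, ∇, g = s² g_M + ds²)` such that `λ s ∂/∂s` is
a radiant vector field for some constant `λ ≠ 0, 1/2`. -/
structure IsHessianCone (gM : SmoothMetric I M) (nabla : AffineConnection (coneModel I) (Cone M))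
    (g : SmoothMetric (coneModel I) (Cone M)) : Prop where
  cone_metric : IsConeMetric gM g
  hessian : IsHessianManifold nabla g
  radiant : ∃ lam : ℝ, lam ≠ 0 ∧ lam ≠ 1 / 2 ∧ IsRadiant nabla (radialField lam)

/-- The formula `∇_X Y = D_X Y - c g_M(X, Y) ρ` for `X`, `Y` tangent to `M`, where
`ρ = λ s ∂/∂s`. It is required at every point `p = (x, s)` of `M × ℝ^{>0}`; on `M = M × {1}` it is
the case `s = 1`. -/
def GaussFormula (gM : SmoothMetric I M) (D : AffineConnection I M) (c lam : ℝ)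
    (nabla : AffineConnection (coneModel I) (Cone M)) : Prop :=
  ∀ (p : Cone M) (v : TangentSpace I p.1) (Y : Π x : M, TangentSpace I x), DiffFieldAt Y p.1 →
    nabla (lift Y) p (horVec p v)
      = horVec p (D Y p.1 v) - (c * gM.inner p.1 v (Y p.1)) • radialField lam p

/-- The connection on `M × ℝ^{>0}` defined, with `ρ = λ s ∂/∂s`, by
`∇_X Y = D_X Y - c g_M(X, Y) ρ`, `∇_X ρ = ∇_ρ X = X` and `∇_ρ ρ = ρ` for `X`, `Y` tangent
to `M`. -/
structure IsConeConnection (gM : SmoothMetric I M) (D : AffineConnection I M) (c lam : ℝ)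
    (nabla : AffineConnection (coneModel I) (Cone M)) : Prop where
  gauss : GaussFormula gM D c lam nabla
  hor_rho : ∀ (p : Cone M) (v : TangentSpace I p.1),
    nabla (radialField lam) p (horVec p v) = horVec p v
  rho_hor : ∀ (p : Cone M) (X : Π x : M, TangentSpace I x), DiffFieldAt X p.1 →
    nabla (lift X) p (radialField lam p) = lift X p
  rho_rho : ∀ p : Cone M, nabla (radialField lam) p (radialField lam p) = radialField lam p

end ConeGeometry

end HessianCone

end

open HessianCone

noncomputable section

set_option linter.unusedSectionVars false

namespace HessianCone

/-! ### Calculus of vector fields on manifolds -/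

section General
variable {E : Type*} [NormedAddCommGroup E] [NormedSpace ℝ E]
  {H : Type*} [TopologicalSpace H] {I : ModelWithCorners ℝ E H}
  {M : Type*} [TopologicalSpace M] [ChartedSpace H M] [IsManifold I ∞ M]
  {F : Type*} [NormedAddCommGroup F] [NormedSpace ℝ F]
open VectorField Filter Topology

/-! The lifts of fields on M commute with ρ (`mlieBracket_radialField_lift`), and since λ ≠ 0 every
tangent vector of the cone is horizontal plus a multiple of ρ (`cone_decomp`). Tensor identities on
the cone are therefore checked on lifts and on ρ.

From the cone to M: ∇ρ = Id, [ρ, X] = 0 and torsion-freeness give ∇_ρ X = X. Flatness on ρ, X, Y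
then gives ∇_ρ ∇_X Y = ∇_X Y, that is [ρ, ∇_X Y] = 0. So the tangential part of ∇_X Y is independent
of s, and it is D_X Y (`basePart_eq_of_mlieBracket_radialField_eq_zero`, `linkConnection`). The
radial part comes from the Codazzi equation of a Hessian metric
(`IsHessianManifold.covDerivMetric_swap`): (∇_X g)(ρ, Y) = (∇_ρ g)(X, Y) reads -g(X, Y) - g(ρ, ∇_X
Y) = (2λ - 2) g(X, Y), and g(ρ, ρ) = λ²s² turns this into the coefficient -c of ρ
(`IsHessianCone.dsPart_nabla_lift`).

Given the Gauss formula with D torsion-free, Θ_∇(X, Y)Z has tangential part Θ_D(X, Y)Z - c (g_M(Y,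
Z) X - g_M(X, Z) Y) and ρ-coefficient -c ((D_X g_M)(Y, Z) - (D_Y g_M)(X, Z)). Flatness of ∇ thus
gives constant curvature of D. The Codazzi equation of g_M is that of g restricted to lifts at s =
1.

From M to the cone: the prescribed values determine a connection (`exists_isConeConnection`). The
same two components show that it is flat on lifts (`IsConeConnection.curvature_lift_lift_lift`). On
ρ its curvature is its torsion, which vanishes. The metric is the Hessian of the global potential
λ/(2(2λ - 1)) s² (`IsConeConnection.isHessianMetric`). -/

lemma mvfderiv_congr {f g : M → F} {x : M} (h : f =ᶠ[𝓝 x] g) :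
    mvfderiv I f x = mvfderiv I g x := by
  ext v
  simp only [mvfderiv, h.mfderiv_eq]
  rfl

lemma contMDiffAt_mvfderiv_apply {f : M → F} {x : M} {V : Π x : M, TangentSpace I x}
    {m n : ℕ∞ω} (hf : ContMDiffAt I 𝓘(ℝ, F) n f x) (hmn : m + 1 ≤ n)
    (hV : ContMDiffAt I I.tangent m (fun y ↦ (⟨y, V y⟩ : TangentBundle I M)) x) :
    ContMDiffAt I 𝓘(ℝ, F) m (fun y ↦ mvfderiv I f y (V y)) x := by
  have h1 := hf.mfderiv_const hmn
  have h2 := ContMDiffAt.clm_apply_of_inCoordinates (b₁ := id) (b₂ := f) h1 hV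
    (hf.of_le (le_trans le_self_add hmn))
  rw [contMDiffAt_totalSpace] at h2
  refine h2.2.congr_of_eventuallyEq (Eventually.of_forall fun y ↦ ?_)
  simp [mvfderiv]
  rfl

lemma mdifferentiableAt_mvfderiv_apply {f : M → F} {x : M} {V : Π x : M, TangentSpace I x}
    {n : ℕ∞ω} (hf : ContMDiffAt I 𝓘(ℝ, F) n f x) (hn : 2 ≤ n) (hV : DiffFieldAt V x) :
    MDifferentiableAt I 𝓘(ℝ, F) (fun y ↦ mvfderiv I f y (V y)) x := by
  have h1 := (hf.mfderiv_const (m := 1) (by simpa [one_add_one_eq_two] using hn)).mdifferentiableAt one_ne_zero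
  have h2 := MDifferentiableAt.clm_apply_of_inCoordinates (b₁ := id) (b₂ := f) h1 hV
    (hf.mdifferentiableAt (by positivity))
  rw [mdifferentiableAt_totalSpace] at h2
  refine h2.2.congr_of_eventuallyEq (Eventually.of_forall fun y ↦ ?_)
  simp [mvfderiv]
  rfl

lemma mvfderiv_comp_extChartAt {h : E → F} {x y : M} (hy : y ∈ (extChartAt I x).source)
    (hh : DifferentiableAt ℝ h (extChartAt I x y)) (v : TangentSpace I y) :
    mvfderiv I (h ∘ extChartAt I x) y v =
      fderiv ℝ h (extChartAt I x y) (mfderiv I 𝓘(ℝ, E) (extChartAt I x) y v) := by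
  have h1 : MDifferentiableAt I 𝓘(ℝ, E) (extChartAt I x) y :=
    mdifferentiableAt_extChartAt (by simpa using hy)
  have := mfderiv_comp_apply y hh.mdifferentiableAt h1 v
  rw [mvfderiv]
  simp only [ContinuousLinearMap.comp_apply]
  rw [this, mfderiv_eq_fderiv]
  rfl

lemma mfderiv_extChartAt_inverse_apply {x y : M} (hy : y ∈ (extChartAt I x).source) (u : E) :
    mfderiv I 𝓘(ℝ, E) (extChartAt I x) y
      ((mfderiv I 𝓘(ℝ, E) (extChartAt I x) y).inverse u) = u :=
  (isInvertible_mfderiv_extChartAt hy).self_apply_inverse u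

lemma eventually_mpullbackWithin_extChartAt_symm_apply (x : M) (V : Π x : M, TangentSpace I x) :
    ∀ᶠ y in 𝓝 x,
      mpullbackWithin 𝓘(ℝ, E) I (extChartAt I x).symm V (Set.range I) (extChartAt I x y) =
        mfderiv I 𝓘(ℝ, E) (extChartAt I x) y (V y) := by
  have h := eventuallyEq_mpullback_mpullbackWithin_extChartAt (I := I) (s := Set.univ) (x := x) V
  rw [nhdsWithin_univ] at h
  filter_upwards [h, extChartAt_source_mem_nhds (I := I) x] with y hy hys
  rw [hy, mpullback_apply]
  exact (mfderiv_extChartAt_inverse_apply hys _).symm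

/-- In the chart at x this is the symmetry of the second derivative of f. Vector values are allowed
so that f can be a chart, which determines the bracket. -/
lemma mvfderiv_mlieBracket [CompleteSpace E] [I.Boundaryless] {f : M → F} {x : M}
    {V W : Π x : M, TangentSpace I x}
    (hf : ContMDiffAt I 𝓘(ℝ, F) ∞ f x) (hV : DiffFieldAt V x) (hW : DiffFieldAt W x) :
    mvfderiv I f x (mlieBracket I V W x) =
      mvfderiv I (fun y ↦ mvfderiv I f y (W y)) x (V x)
        - mvfderiv I (fun y ↦ mvfderiv I f y (V y)) x (W x) := by
  set φ := extChartAt I x with hφ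
  have hxs : x ∈ φ.source := mem_extChartAt_source x
  have hsrc : ∀ᶠ y in 𝓝 x, y ∈ φ.source := extChartAt_source_mem_nhds x
  set f' : E → F := f ∘ φ.symm with hf'
  have hf'c : ContDiffAt ℝ ∞ f' (φ x) := by
    have h1 : ContMDiffAt 𝓘(ℝ, E) I ∞ φ.symm (φ x) := by
      have := contMDiffWithinAt_extChartAt_symm_range (I := I) (n := ∞) x (mem_extChartAt_target x)
      rwa [I.range_eq_univ, contMDiffWithinAt_univ] at this
    have h2 : ContMDiffAt I 𝓘(ℝ, F) ∞ f (φ.symm (φ x)) := by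
      rwa [φ.left_inv hxs]
    exact (h2.comp _ h1).contDiffAt
  have hff : ∀ y ∈ φ.source, f y = (f' ∘ φ) y := fun y hy ↦ by simp [f', φ.left_inv hy]
  have hffe : ∀ y ∈ φ.source, f =ᶠ[𝓝 y] f' ∘ φ := fun y hy ↦
    Filter.eventually_of_mem ((isOpen_extChartAt_source x).mem_nhds hy) hff
  have hd : ∀ᶠ y in 𝓝 x, DifferentiableAt ℝ f' (φ y) := by
    have : ∀ᶠ z in 𝓝 (φ x), ContDiffAt ℝ 1 f' z :=
      (hf'c.of_le (by norm_cast)).eventually (by norm_num)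
    exact ((continuousAt_extChartAt x).eventually this).mono fun y hy ↦
      hy.differentiableAt one_ne_zero
  have key : ∀ Z : Π x : M, TangentSpace I x, ∀ᶠ y in 𝓝 x, mvfderiv I f y (Z y) =
      ((fun z ↦ fderiv ℝ f' z
        (mpullbackWithin 𝓘(ℝ, E) I φ.symm Z (Set.range I) z)) ∘ φ) y := fun Z ↦ by
    filter_upwards [hsrc, hd, eventually_mpullbackWithin_extChartAt_symm_apply x Z] with y hy hdy hZ
    rw [mvfderiv_congr (hffe y hy), mvfderiv_comp_extChartAt hy hdy]
    simp only [Function.comp_apply]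
    rw [hZ]
  have hdiff : ∀ Z : Π x : M, TangentSpace I x, DiffFieldAt Z x → DifferentiableAt ℝ
      (mpullbackWithin 𝓘(ℝ, E) I φ.symm Z (Set.range I)) (φ x) := fun Z hZ ↦ by
    have := MDifferentiableWithinAt.differentiableWithinAt_mpullbackWithin_vectorField
      (s := Set.univ) (mdifferentiableWithinAt_univ.2 hZ)
    exact this.differentiableAt (by simp [I.range_eq_univ])
  have hD2 : DifferentiableAt ℝ (fderiv ℝ f') (φ x) :=
    (hf'c.fderiv_right (m := 1) (by norm_cast)).differentiableAt one_ne_zero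
  have hdiff2 : ∀ Z : Π x : M, TangentSpace I x, DiffFieldAt Z x → DifferentiableAt ℝ
      (fun z ↦ fderiv ℝ f' z (mpullbackWithin 𝓘(ℝ, E) I φ.symm Z (Set.range I) z)) (φ x) :=
    fun Z hZ ↦ hD2.clm_apply (hdiff Z hZ)
  rw [mvfderiv_congr (key W), mvfderiv_congr (key V),
    mvfderiv_comp_extChartAt hxs (hdiff2 W hW), mvfderiv_comp_extChartAt hxs (hdiff2 V hV),
    ← (eventually_mpullbackWithin_extChartAt_symm_apply x V).self_of_nhds,
    ← (eventually_mpullbackWithin_extChartAt_symm_apply x W).self_of_nhds,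
    mvfderiv_congr (hffe x hxs), mvfderiv_comp_extChartAt hxs hd.self_of_nhds,
    ← fderiv_apply_lieBracket hf'c (by simp; norm_cast) (hdiff W hW) (hdiff V hV)]
  congr 1
  have hA := isInvertible_mfderiv_extChartAt (I := I) hxs
  rw [← mlieBracketWithin_univ, mlieBracketWithin_apply, Set.preimage_univ, Set.univ_inter]
  refine (mfderiv_extChartAt_inverse_apply hxs _).trans ?_
  have := lieBracketWithin_univ (𝕜 := ℝ) 
     (V := mpullbackWithin 𝓘(ℝ, E) I φ.symm V (Set.range I)) (W := mpullbackWithin 𝓘(ℝ, E) I φ.symm W (Set.range I))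
  rw [← this, ← I.range_eq_univ]

lemma exists_smooth_eventuallyEq [FiniteDimensional ℝ E] [T2Space M] {U : Set M} (hU : IsOpen U)
    {x : M} (hx : x ∈ U) {V : Π x : M, TangentSpace I x}
    (hV : ContMDiffOn I I.tangent ∞ (fun y ↦ (⟨y, V y⟩ : TangentBundle I M)) U) :
    ∃ Y : Π x : M, TangentSpace I x, SmoothField Y ∧ Y =ᶠ[𝓝 x] V := by
  obtain ⟨f, -, hf⟩ := (SmoothBumpFunction.nhds_basis_tsupport (I := I) x).mem_iff.1
    (hU.mem_nhds hx)
  refine ⟨(f : M → ℝ) • V, ContMDiffOn.smul_section_of_tsupport f.contMDiff.contMDiffOn hU hf hV,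
    ?_⟩
  filter_upwards [f.eventuallyEq_one] with y hy
  simp [hy]
  rfl

lemma exists_smoothField_eq [FiniteDimensional ℝ E] [T2Space M] {x : M} (v : TangentSpace I x) :
    ∃ Y : Π x : M, TangentSpace I x, SmoothField Y ∧ Y x = v := by
  obtain ⟨s, hs, h⟩ := FiberBundle.exists_contMDiffOn_extend (k := ∞) I E v
  obtain ⟨U, hUs, hU, hx⟩ := mem_nhds_iff.1 hs
  obtain ⟨Y, hY, hYe⟩ := exists_smooth_eventuallyEq hU hx (h.mono hUs)
  exact ⟨Y, hY, by simp [hYe.self_of_nhds]⟩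

lemma SmoothField.diffFieldAt {Y : Π x : M, TangentSpace I x} (hY : SmoothField Y) (x : M) :
    DiffFieldAt Y x :=
  (hY x).mdifferentiableAt (by simp)

lemma contMDiffAt_clm_of_apply {G : Type*} [NormedAddCommGroup G] [NormedSpace ℝ G]
    [FiniteDimensional ℝ F] {n : ℕ∞ω} {T : M → F →L[ℝ] G} {x : M}
    (h : ∀ u, ContMDiffAt I 𝓘(ℝ, G) n (fun y ↦ T y u) x) :
    ContMDiffAt I 𝓘(ℝ, F →L[ℝ] G) n T x := by
  let b := Module.finBasis ℝ F
  have hT : T = fun y ↦ ∑ i, ContinuousLinearMap.smulRightL ℝ F G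
      (LinearMap.toContinuousLinearMap (b.coord i)) (T y (b i)) := by
    ext y u
    conv_lhs => rw [← b.sum_repr u, map_sum]
    simp
  rw [hT]
  exact ContMDiffAt.sum fun i _ ↦ (ContinuousLinearMap.contMDiff _).contMDiffAt.comp x (h _)

/-- In a trivialization the matrix of φ is read off from its values on constant vectors, and these
are sections that are smooth near x. -/
lemma contMDiffAt_hom_section {V : M → Type*} [TopologicalSpace (TotalSpace F V)]
    [∀ x, AddCommGroup (V x)] [∀ x, Module ℝ (V x)] [∀ x, TopologicalSpace (V x)]
    [FiberBundle F V] [VectorBundle ℝ F V] [FiniteDimensional ℝ F]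
    {G : Type*} [NormedAddCommGroup G] [NormedSpace ℝ G]
    {W : M → Type*} [TopologicalSpace (TotalSpace G W)]
    [∀ x, AddCommGroup (W x)] [∀ x, Module ℝ (W x)] [∀ x, TopologicalSpace (W x)]
    [∀ x, IsTopologicalAddGroup (W x)] [∀ x, ContinuousSMul ℝ (W x)]
    [FiberBundle G W] [VectorBundle ℝ G W] {n : ℕ∞ω} [ContMDiffVectorBundle n F V I]
    [ContMDiffVectorBundle n G W I]
    {φ : Π x, V x →L[ℝ] W x} {x : M}
    (h : ∀ σ : Π x, V x, ContMDiffAt I (I.prod 𝓘(ℝ, F)) n (fun y ↦ TotalSpace.mk' F y (σ y)) x →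
      ContMDiffAt I (I.prod 𝓘(ℝ, G)) n (fun y ↦ TotalSpace.mk' G y (φ y (σ y))) x) :
    ContMDiffAt I (I.prod 𝓘(ℝ, F →L[ℝ] G)) n
      (fun y ↦ TotalSpace.mk' (F →L[ℝ] G) (E := fun x ↦ V x →L[ℝ] W x) y (φ y)) x := by
  rw [contMDiffAt_hom_bundle]
  refine ⟨contMDiffAt_id, contMDiffAt_clm_of_apply fun u ↦ ?_⟩
  set e := trivializationAt F V x
  have hx : x ∈ e.baseSet := FiberBundle.mem_baseSet_trivializationAt' x
  have hx' : x ∈ (trivializationAt G W x).baseSet := FiberBundle.mem_baseSet_trivializationAt' x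
  have h1 : ContMDiffAt I (I.prod 𝓘(ℝ, F)) n
      (fun y ↦ TotalSpace.mk' F y (e.symmL ℝ y u)) x := by
    rw [e.contMDiffAt_section_iff hx]
    refine contMDiffAt_const (c := u) |>.congr_of_eventuallyEq ?_
    filter_upwards [e.open_baseSet.mem_nhds hx] with y hy
    simp [hy]
  have h2 := h _ h1
  rw [(trivializationAt G W x).contMDiffAt_section_iff hx'] at h2
  refine h2.congr_of_eventuallyEq ?_
  filter_upwards [e.open_baseSet.mem_nhds hx,
    (trivializationAt G W x).open_baseSet.mem_nhds hx'] with y hy hy'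
  rw [ContinuousLinearMap.inCoordinates_eq hy hy', Bundle.Trivialization.symmL_apply _ hy]
  simp [e]

end General

/-! ### Connections: locality, tensoriality of curvature, the Codazzi equation -/

section Connection
variable {E : Type*} [NormedAddCommGroup E] [NormedSpace ℝ E]
  {H : Type*} [TopologicalSpace H] {I : ModelWithCorners ℝ E H}
  {M : Type*} [TopologicalSpace M] [ChartedSpace H M] [IsManifold I ∞ M]
  {nabla : AffineConnection I M} {g : SmoothMetric I M}
  {X Y Z : Π x : M, TangentSpace I x} {x : M}
open VectorField Filter Topology

lemma DiffFieldAt.add (hX : DiffFieldAt X x) (hY : DiffFieldAt Y x) : DiffFieldAt (X + Y) x :=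
  mdifferentiableAt_add_section hX hY

lemma DiffFieldAt.smul {f : M → ℝ} (hf : MDifferentiableAt I 𝓘(ℝ) f x) (hX : DiffFieldAt X x) :
    DiffFieldAt (f • X) x :=
  hf.smul_section hX

lemma SmoothField.add (hX : SmoothField X) (hY : SmoothField Y) : SmoothField (X + Y) :=
  ContMDiff.add_section hX hY

lemma SmoothField.smul {f : M → ℝ} (hf : ContMDiff I 𝓘(ℝ) ∞ f) (hX : SmoothField X) :
    SmoothField (f • X) :=
  ContMDiff.smul_section hf hX

lemma nabla_congr (hX : DiffFieldAt X x) (hY : DiffFieldAt Y x) (h : X =ᶠ[𝓝 x] Y) :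
    nabla X x = nabla Y x :=
  nabla.isCovariantDerivativeOnUniv.congr_of_eventuallyEq hX hY univ_mem h

lemma nabla_add (hX : DiffFieldAt X x) (hY : DiffFieldAt Y x) (v : TangentSpace I x) :
    nabla (X + Y) x v = nabla X x v + nabla Y x v := by
  rw [nabla.isCovariantDerivativeOnUniv.add hX hY]
  rfl

lemma nabla_smul {f : M → ℝ} (hX : DiffFieldAt X x) (hf : MDifferentiableAt I 𝓘(ℝ) f x)
    (v : TangentSpace I x) :
    nabla (f • X) x v = f x • nabla X x v + mvfderiv I f x v • X x := by
  rw [nabla.isCovariantDerivativeOnUniv.leibniz hX hf]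
  rfl

lemma nabla_const_smul (a : ℝ) (hX : DiffFieldAt X x) (v : TangentSpace I x) :
    nabla (a • X) x v = a • nabla X x v := by
  rw [nabla.isCovariantDerivativeOnUniv.smul_const a hX]
  rfl

lemma contMDiff_nabla (hs : CovariantDerivative.ContMDiffCovariantDerivative nabla ∞)
    (hX : SmoothField X) :
    ContMDiff I (I.prod 𝓘(ℝ, E →L[ℝ] E)) ∞ (fun y ↦ (⟨y, nabla X y⟩ :
      TotalSpace (E →L[ℝ] E) fun y : M ↦ TangentSpace I y →L[ℝ] TangentSpace I y)) :=
  contMDiffOn_univ.1 (hs.contMDiff.contMDiff (contMDiffOn_univ.2 hX))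

lemma smoothField_nabla (hs : CovariantDerivative.ContMDiffCovariantDerivative nabla ∞)
    (hX : SmoothField X) (hY : SmoothField Y) : SmoothField (fun y ↦ nabla X y (Y y)) :=
  (contMDiff_nabla hs hX).clm_bundle_apply hY

lemma diffFieldAt_nabla (hs : CovariantDerivative.ContMDiffCovariantDerivative nabla ∞)
    (hX : SmoothField X) (hY : DiffFieldAt Y x) : DiffFieldAt (fun y ↦ nabla X y (Y y)) x :=
  MDifferentiableAt.clm_bundle_apply ((contMDiff_nabla hs hX x).mdifferentiableAt (by simp)) hY

lemma mdifferentiableAt_metric_apply (g : SmoothMetric I M) (hX : DiffFieldAt X x)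
    (hY : DiffFieldAt Y x) : MDifferentiableAt I 𝓘(ℝ) (fun y ↦ g.inner y (X y) (Y y)) x := by
  have h := MDifferentiableAt.clm_bundle_apply₂ (E₃ := Bundle.Trivial M ℝ) (F₃ := ℝ)
    ((g.contMDiff x).mdifferentiableAt (by simp)) hX hY
  exact ((mdifferentiableAt_totalSpace ..).1 h).2

lemma curvature_swap : curvature nabla X Y Z x = - curvature nabla Y X Z x := by
  simp only [curvature, mlieBracket_swap_apply (V := X), map_neg]
  abel

section Tensoriality
variable [FiniteDimensional ℝ E]

lemma tensorialAt_curvature (hs : CovariantDerivative.ContMDiffCovariantDerivative nabla ∞)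
    (hZ : SmoothField Z) :
    TensorialAt I E (fun X ↦ curvature nabla X Y Z x) x where
  smul {f X} hf hX := by
    have h1 : (fun y ↦ nabla Z y ((f • X) y)) = f • fun y ↦ nabla Z y (X y) := by
      ext y; simp
    simp only [curvature, h1]
    simp only [nabla_smul (diffFieldAt_nabla hs hZ hX) hf, mlieBracket_smul_left hf hX, map_add,
      map_smul, Pi.smul_apply']
    module
  add {X X'} hX hX' := by
    have h1 : (fun y ↦ nabla Z y ((X + X') y)) =
        (fun y ↦ nabla Z y (X y)) + fun y ↦ nabla Z y (X' y) := by
      ext y; simp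
    simp only [curvature, h1]
    simp only [nabla_add (diffFieldAt_nabla hs hZ hX) (diffFieldAt_nabla hs hZ hX'),
      mlieBracket_add_left hX hX', map_add, Pi.add_apply]
    module

lemma curvature_congr_right {Z' : Π x : M, TangentSpace I x}
    (hs : CovariantDerivative.ContMDiffCovariantDerivative nabla ∞)
    (hX : DiffFieldAt X x) (hY : DiffFieldAt Y x) (hZ : SmoothField Z) (hZ' : SmoothField Z')
    (h : Z =ᶠ[𝓝 x] Z') : curvature nabla X Y Z x = curvature nabla X Y Z' x := by
  have h1 : ∀ W : Π x : M, TangentSpace I x,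
      (fun y ↦ nabla Z y (W y)) =ᶠ[𝓝 x] fun y ↦ nabla Z' y (W y) := fun W ↦ by
    filter_upwards [h.eventuallyEq_nhds] with y hy
    rw [nabla_congr (hZ.diffFieldAt y) (hZ'.diffFieldAt y) hy]
  simp only [curvature, nabla_congr (diffFieldAt_nabla hs hZ hX) (diffFieldAt_nabla hs hZ' hX) (h1 X),
    nabla_congr (diffFieldAt_nabla hs hZ hY) (diffFieldAt_nabla hs hZ' hY) (h1 Y),
    nabla_congr (hZ.diffFieldAt x) (hZ'.diffFieldAt x) h]

lemma curvature_add_right {Z' : Π x : M, TangentSpace I x}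
    (hs : CovariantDerivative.ContMDiffCovariantDerivative nabla ∞)
    (hX : DiffFieldAt X x) (hY : DiffFieldAt Y x) (hZ : SmoothField Z) (hZ' : SmoothField Z') :
    curvature nabla X Y (Z + Z') x = curvature nabla X Y Z x + curvature nabla X Y Z' x := by
  have h1 : ∀ W : Π x : M, TangentSpace I x, (fun y ↦ nabla (Z + Z') y (W y)) =
      (fun y ↦ nabla Z y (W y)) + fun y ↦ nabla Z' y (W y) := fun W ↦ by
    ext y
    rw [nabla_add (hZ.diffFieldAt y) (hZ'.diffFieldAt y)]
    rfl
  simp only [curvature, h1, nabla_add (diffFieldAt_nabla hs hZ hX) (diffFieldAt_nabla hs hZ' hX),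
    nabla_add (diffFieldAt_nabla hs hZ hY) (diffFieldAt_nabla hs hZ' hY),
    nabla_add (hZ.diffFieldAt x) (hZ'.diffFieldAt x)]
  module

/-- The terms with one derivative of f cancel in pairs, and the coefficient of Z is X(Yf) - Y(Xf) -
[X, Y]f = 0. -/
lemma curvature_smul_right [I.Boundaryless] {f : M → ℝ} (hf : ContMDiff I 𝓘(ℝ) ∞ f)
    (hs : CovariantDerivative.ContMDiffCovariantDerivative nabla ∞)
    (hX : DiffFieldAt X x) (hY : DiffFieldAt Y x) (hZ : SmoothField Z) :
    curvature nabla X Y (f • Z) x = f x • curvature nabla X Y Z x := by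
  have hfd : ∀ y, MDifferentiableAt I 𝓘(ℝ) f y := fun y ↦ (hf y).mdifferentiableAt (by simp)
  have h1 : ∀ W : Π x : M, TangentSpace I x, (fun y ↦ nabla (f • Z) y (W y)) =
      (f • fun y ↦ nabla Z y (W y)) + (fun y ↦ mvfderiv I f y (W y)) • Z := fun W ↦ by
    ext y
    rw [nabla_smul (hZ.diffFieldAt y) (hfd y)]
    rfl
  have h2 : ∀ {W : Π x : M, TangentSpace I x}, DiffFieldAt W x →
      MDifferentiableAt I 𝓘(ℝ) (fun y ↦ mvfderiv I f y (W y)) x := fun hW ↦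
    mdifferentiableAt_mvfderiv_apply (hf x) (by norm_cast) hW
  have hZx := hZ.diffFieldAt x
  simp only [curvature, h1,
    nabla_add (.smul (hfd x) (diffFieldAt_nabla hs hZ hX)) (.smul (h2 hX) hZx),
    nabla_add (.smul (hfd x) (diffFieldAt_nabla hs hZ hY)) (.smul (h2 hY) hZx),
    nabla_smul (diffFieldAt_nabla hs hZ hX) (hfd x), nabla_smul (diffFieldAt_nabla hs hZ hY) (hfd x),
    nabla_smul hZx (h2 hX), nabla_smul hZx (h2 hY), nabla_smul hZx (hfd x),
    mvfderiv_mlieBracket (hf x) hX hY]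
  module

/-- The Codazzi equation of a Hessian metric. -/
lemma IsHessianManifold.covDerivMetric_swap [I.Boundaryless] (h : IsHessianManifold nabla g)
    (hX : SmoothField X) (hY : SmoothField Y) (hZ : SmoothField Z) (x : M) :
    covDerivMetric nabla g X Y Z x = covDerivMetric nabla g Y X Z x := by
  obtain ⟨U, hU, hxU, φ, hφ, hess_eq⟩ := h.hessian x
  have hs := h.flat_affine.smooth
  have hφx : ContMDiffAt I 𝓘(ℝ) ∞ φ x := hφ.contMDiffAt (hU.mem_nhds hxU)
  have hφd : ∀ {W : Π x : M, TangentSpace I x}, SmoothField W →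
      ContMDiffAt I 𝓘(ℝ) ∞ (fun y ↦ mvfderiv I φ y (W y)) x := fun hW ↦
    contMDiffAt_mvfderiv_apply hφx (by norm_cast) (hW x)
  have hφm : ∀ {W : Π x : M, TangentSpace I x}, SmoothField W →
      MDifferentiableAt I 𝓘(ℝ) (fun y ↦ mvfderiv I φ y (W y)) x := fun hW ↦
    (hφd hW).mdifferentiableAt (by simp)
  have hφm2 : ∀ {W V : Π x : M, TangentSpace I x}, SmoothField W → SmoothField V →
      MDifferentiableAt I 𝓘(ℝ)
        (fun y ↦ mvfderiv I (fun y ↦ mvfderiv I φ y (W y)) y (V y)) x := fun hW hV ↦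
    mdifferentiableAt_mvfderiv_apply (hφd hW) (by norm_cast) (hV.diffFieldAt x)
  have h1 : ∀ {V W : Π x : M, TangentSpace I x}, SmoothField V → SmoothField W →
      mvfderiv I (fun y ↦ g.inner y (V y) (W y)) x =
        mvfderiv I (fun y ↦ mvfderiv I (fun y ↦ mvfderiv I φ y (W y)) y (V y)) x
        - mvfderiv I (fun y ↦ mvfderiv I φ y (nabla W y (V y))) x := fun {V W} hV hW ↦ by
    rw [← mvfderiv_sub (hφm2 hW hV) (hφm (smoothField_nabla hs hW hV))]
    refine mvfderiv_congr ?_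
    filter_upwards [hU.mem_nhds hxU] with y hy
    rw [hess_eq y hy _ _ (hW.diffFieldAt y)]
    rfl
  -- Insert g(V, W) = V(Wφ) - (∇_V W)φ, merging g(∇_X Y, Z) - g(∇_Y X, Z) into g([X, Y], Z) by
  -- torsion-freeness. In the difference of the two sides the third derivatives of φ cancel by the
  -- bracket identity, the derivatives of (∇_Y Z)φ and (∇_X Z)φ cancel in pairs, and what remains is
  -- (Θ(X, Y)Z)φ up to sign.
  have htor := h.flat_affine.torsion_free X Y hX hY x
  have hflat := congrArg (mvfderiv I φ x) (h.flat_affine.flat X Y Z hX hY hZ x)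
  have hbr := mvfderiv_mlieBracket (hφd hZ) (hX.diffFieldAt x) (hY.diffFieldAt x)
  have e1 := hess_eq x hxU (mlieBracket I X Y x) Z (hZ.diffFieldAt x)
  have e2 := hess_eq x hxU (Y x) _ ((smoothField_nabla hs hZ hX).diffFieldAt x)
  have e3 := hess_eq x hxU (X x) _ ((smoothField_nabla hs hZ hY).diffFieldAt x)
  rw [curvature, ← htor] at hflat
  rw [← htor] at e1 hbr
  simp only [hess, map_sub, map_zero, sub_apply] at e1 e2 e3 hflat hbr
  simp only [covDerivMetric, h1 hX hZ, h1 hY hZ, sub_apply]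
  linarith
end Tensoriality
end Connection

/-! ### The half-line -/

section PosReal

lemma contMDiff_posReal_val : ContMDiff 𝓘(ℝ) 𝓘(ℝ) ∞ (fun s : PosReal ↦ (s : ℝ)) :=
  contMDiff_subtype_val

/-- All preferred charts of the half-line are the inclusion into ℝ, so the change of coordinates
from s to t is that from s to itself. -/
lemma trivializationAt_posReal (s t : PosReal) (a : TangentSpace 𝓘(ℝ) s) :
    (trivializationAt ℝ (TangentSpace 𝓘(ℝ) : PosReal → Type) t ⟨s, a⟩).2 = a := by
  rw [TangentBundle.trivializationAt_apply]
  have h : s ∈ (chartAt ℝ s).source := mem_chart_source ℝ s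
  have := (tangentBundleCore 𝓘(ℝ) PosReal).coordChange_self (achart ℝ s) s h a
  exact this

lemma mvfderiv_posReal_val (s : PosReal) (a : TangentSpace 𝓘(ℝ) s) :
    mvfderiv 𝓘(ℝ) (fun s : PosReal ↦ (s : ℝ)) s a = a := by
  have h : mfderiv 𝓘(ℝ) 𝓘(ℝ) (extChartAt 𝓘(ℝ) s) s = ContinuousLinearMap.id ℝ ℝ :=
    mfderiv_extChartAt_self
  exact congrArg (fun T : ℝ →L[ℝ] ℝ ↦ T a) h

end PosReal

/-! ### Lifts, the radial field and their brackets on the cone -/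

section Cone
variable {E : Type*} [NormedAddCommGroup E] [NormedSpace ℝ E]
  {H : Type*} [TopologicalSpace H] {I : ModelWithCorners ℝ E H}
  {M : Type*} [TopologicalSpace M] [ChartedSpace H M] [IsManifold I ∞ M]
  {F : Type*} [NormedAddCommGroup F] [NormedSpace ℝ F]
  {X Y Z : Π x : M, TangentSpace I x} {p : Cone M} {lam : ℝ}
open VectorField Filter Topology

/-- The coordinate `s` on `M × ℝ^{>0}`. -/
def height (p : Cone M) : ℝ := p.2

lemma height_pos (p : Cone M) : 0 < height p := p.2.2

lemma basePart_eq (w : TangentSpace (coneModel I) p) : basePart p w = (w : E × ℝ).1 := by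
  rw [basePart, mfderiv_fst]
  rfl

lemma contMDiff_height : ContMDiff (coneModel I) 𝓘(ℝ) ∞ (height : Cone M → ℝ) :=
  contMDiff_posReal_val.comp contMDiff_snd

lemma dsPart_eq (w : TangentSpace (coneModel I) p) : dsPart p w = (w : E × ℝ).2 := by
  have h := mfderiv_comp_apply (I := coneModel I) (I' := 𝓘(ℝ)) p
    (f := (Prod.snd : Cone M → PosReal)) (g := fun s : PosReal ↦ (s : ℝ))
    ((contMDiff_posReal_val _).mdifferentiableAt (by simp)) mdifferentiableAt_snd w
  refine h.trans ?_
  rw [mfderiv_snd]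
  exact mvfderiv_posReal_val p.2 _

lemma mvfderiv_height (w : TangentSpace (coneModel I) p) :
    mvfderiv (coneModel I) height p w = dsPart p w := rfl

lemma basePart_horVec (v : TangentSpace I p.1) : basePart p (horVec p v) = v := basePart_eq _

lemma dsPart_horVec (v : TangentSpace I p.1) : dsPart p (horVec p v) = 0 := dsPart_eq _

lemma basePart_radialField : basePart p (radialField (I := I) lam p) = 0 := basePart_eq _

lemma dsPart_radialField : dsPart p (radialField (I := I) lam p) = lam * height p := dsPart_eq _

lemma cone_ext {w w' : TangentSpace (coneModel I) p} (h : basePart p w = basePart p w')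
    (h' : dsPart p w = dsPart p w') : w = w' := by
  rw [basePart_eq, basePart_eq] at h
  rw [dsPart_eq, dsPart_eq] at h'
  exact Prod.ext h h'

/-- `basePart` as a continuous linear map. -/
def basePartL (p : Cone M) : TangentSpace (coneModel I) p →L[ℝ] TangentSpace I p.1 :=
  mfderiv (coneModel I) I (Prod.fst : Cone M → M) p

/-- `horVec` as a continuous linear map. -/
def horVecL (p : Cone M) : TangentSpace I p.1 →L[ℝ] TangentSpace (coneModel I) p :=
  ContinuousLinearMap.inl ℝ E ℝ

lemma basePart_add (w w' : TangentSpace (coneModel I) p) :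
    basePart p (w + w') = basePart p w + basePart p w' := map_add (basePartL p) w w'

@[simp] lemma basePart_zero : basePart p (0 : TangentSpace (coneModel I) p) = 0 :=
  map_zero (basePartL p)

@[simp] lemma dsPart_zero : dsPart p (0 : TangentSpace (coneModel I) p) = 0 :=
  map_zero (mvfderiv (coneModel I) height p)

lemma basePart_sub (w w' : TangentSpace (coneModel I) p) :
    basePart p (w - w') = basePart p w - basePart p w' := map_sub (basePartL p) w w'

lemma basePart_smul (a : ℝ) (w : TangentSpace (coneModel I) p) :
    basePart p (a • w) = a • basePart p w := map_smul (basePartL p) a w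

lemma dsPart_add (w w' : TangentSpace (coneModel I) p) :
    dsPart p (w + w') = dsPart p w + dsPart p w' := map_add (mvfderiv (coneModel I) height p) w w'

lemma dsPart_sub (w w' : TangentSpace (coneModel I) p) :
    dsPart p (w - w') = dsPart p w - dsPart p w' := map_sub (mvfderiv (coneModel I) height p) w w'

lemma dsPart_smul (a : ℝ) (w : TangentSpace (coneModel I) p) :
    dsPart p (a • w) = a * dsPart p w := map_smul (mvfderiv (coneModel I) height p) a w

lemma horVec_add (v v' : TangentSpace I p.1) :
    horVec p (v + v') = horVec p v + horVec p v' := map_add (horVecL p) v v'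

lemma horVec_sub (v v' : TangentSpace I p.1) :
    horVec p (v - v') = horVec p v - horVec p v' := map_sub (horVecL p) v v'

lemma horVec_smul (a : ℝ) (v : TangentSpace I p.1) :
    horVec p (a • v) = a • horVec p v := map_smul (horVecL p) a v

lemma cone_decomp (hlam : lam ≠ 0) (w : TangentSpace (coneModel I) p) :
    w = horVec p (basePart p w) + (dsPart p w / (lam * height p)) • radialField lam p := by
  have := (height_pos p).ne'
  apply cone_ext
  · rw [basePart_add, basePart_horVec, basePart_smul, basePart_radialField, smul_zero, add_zero]
  · rw [dsPart_add, dsPart_horVec, dsPart_smul, dsPart_radialField]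
    field_simp
    simp

lemma mvfderiv_comp_fst {f : M → F} (hf : MDifferentiableAt I 𝓘(ℝ, F) f p.1)
    (w : TangentSpace (coneModel I) p) :
    mvfderiv (coneModel I) (fun q : Cone M ↦ f q.1) p w = mvfderiv I f p.1 (basePart p w) := by
  have h := mfderiv_comp_apply (I := coneModel I) (I' := I) p
    (f := (Prod.fst : Cone M → M)) (g := f) hf mdifferentiableAt_fst w
  exact h

lemma mfderiv_slice (x : M) (s : PosReal) :
    mfderiv I (coneModel I) (fun y : M ↦ ((y, s) : Cone M)) x = horVecL (x, s) :=
  mfderiv_prod_left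

lemma mdifferentiableAt_slice (x : M) (s : PosReal) :
    MDifferentiableAt I (coneModel I) (fun y : M ↦ ((y, s) : Cone M)) x :=
  mdifferentiableAt_id.prodMk mdifferentiableAt_const

lemma mvfderiv_slice {f : Cone M → F} (hf : MDifferentiableAt (coneModel I) 𝓘(ℝ, F) f p)
    (v : TangentSpace I p.1) :
    mvfderiv I (fun y ↦ f (y, p.2)) p.1 v = mvfderiv (coneModel I) f p (horVec p v) := by
  have h := mfderiv_comp_apply (I := I) (I' := coneModel I) p.1
    (f := fun y : M ↦ ((y, p.2) : Cone M)) (g := f) hf (mdifferentiableAt_slice ..) v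
  rw [mfderiv_slice] at h
  exact h

lemma contMDiffAt_basePart {n : ℕ∞ω} {σ : Π p : Cone M, TangentSpace (coneModel I) p}
    (hσ : ContMDiffAt (coneModel I) (coneModel I).tangent n
      (fun q ↦ (⟨q, σ q⟩ : TangentBundle (coneModel I) (Cone M))) p) :
    ContMDiffAt (coneModel I) I.tangent n
      (fun q ↦ (⟨q.1, basePart q (σ q)⟩ : TangentBundle I M)) p :=
  ((contMDiff_fst (n := n + 1)).contMDiff_tangentMap le_rfl).contMDiffAt.comp p hσ

lemma mdifferentiableAt_basePart {σ : Π p : Cone M, TangentSpace (coneModel I) p}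
    (hσ : DiffFieldAt σ p) :
    MDifferentiableAt (coneModel I) I.tangent
      (fun q ↦ (⟨q.1, basePart q (σ q)⟩ : TangentBundle I M)) p :=
  (((contMDiff_fst (n := 2)).contMDiff_tangentMap (m := 1) (by norm_num)).mdifferentiableAt
    one_ne_zero).comp p hσ

lemma contMDiffAt_dsPart {n : ℕ∞ω} (hn : n + 1 ≤ ∞)
    {σ : Π p : Cone M, TangentSpace (coneModel I) p}
    (hσ : ContMDiffAt (coneModel I) (coneModel I).tangent n
      (fun q ↦ (⟨q, σ q⟩ : TangentBundle (coneModel I) (Cone M))) p) :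
    ContMDiffAt (coneModel I) 𝓘(ℝ) n (fun q ↦ dsPart q (σ q)) p :=
  contMDiffAt_mvfderiv_apply (contMDiff_height p) hn hσ

lemma mdifferentiableAt_dsPart {σ : Π p : Cone M, TangentSpace (coneModel I) p}
    (hσ : DiffFieldAt σ p) :
    MDifferentiableAt (coneModel I) 𝓘(ℝ) (fun q ↦ dsPart q (σ q)) p :=
  mdifferentiableAt_mvfderiv_apply (contMDiff_height p) (by norm_cast) hσ

lemma contMDiff_zero_posReal :
    ContMDiff 𝓘(ℝ) 𝓘(ℝ).tangent ∞ (fun s : PosReal ↦ (⟨s, 0⟩ : TangentBundle 𝓘(ℝ) PosReal)) :=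
  contMDiff_zeroSection ℝ (TangentSpace 𝓘(ℝ) : PosReal → Type _)

lemma SmoothField.lift (hY : SmoothField Y) : SmoothField (lift (I := I) Y) :=
  (contMDiff_equivTangentBundleProd_symm (n := ∞) (I := I) (I' := 𝓘(ℝ)) (M := M)
    (M' := PosReal)).comp
    ((hY.comp contMDiff_fst).prodMk (contMDiff_zero_posReal.comp contMDiff_snd))

lemma DiffFieldAt.lift (hY : DiffFieldAt Y p.1) : DiffFieldAt (lift (I := I) Y) p :=
  (((contMDiff_equivTangentBundleProd_symm (n := ∞) (I := I) (I' := 𝓘(ℝ)) (M := M)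
    (M' := PosReal)) _).mdifferentiableAt (by simp)).comp p
    ((hY.comp p mdifferentiableAt_fst).prodMk
      (((contMDiff_zero_posReal p.2).mdifferentiableAt (by simp)).comp p mdifferentiableAt_snd))

lemma smoothField_radialField (lam : ℝ) : SmoothField (radialField (I := I) (M := M) lam) := by
  have h : ContMDiff 𝓘(ℝ) 𝓘(ℝ).tangent ∞
      (fun s : PosReal ↦ (⟨s, lam * (s : ℝ)⟩ : TangentBundle 𝓘(ℝ) PosReal)) := fun s ↦ by
    have h0 : ContMDiffAt 𝓘(ℝ) 𝓘(ℝ) ∞ (fun s : PosReal ↦ lam * (s : ℝ)) s :=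
      contMDiffAt_const.mul (contMDiff_posReal_val s)
    refine contMDiffAt_totalSpace.2 ⟨contMDiffAt_id, h0.congr_of_eventuallyEq ?_⟩
    exact .of_forall fun x ↦ trivializationAt_posReal x s _
  exact (contMDiff_equivTangentBundleProd_symm (n := ∞) (I := I) (I' := 𝓘(ℝ)) (M := M)
    (M' := PosReal)).comp
    (((contMDiff_zeroSection ℝ (TangentSpace I : M → Type _)).comp contMDiff_fst).prodMk
      (h.comp contMDiff_snd))

section Bracket
variable [CompleteSpace E] [I.Boundaryless]

/-- The chart at p.1 has the identity as derivative there, so the base part of the bracket is the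
derivative along the bracket of that chart pulled back to the cone. -/
lemma basePart_mlieBracket_eq {σ τ : Π p : Cone M, TangentSpace (coneModel I) p}
    (hσ : DiffFieldAt σ p) (hτ : DiffFieldAt τ p) {v : TangentSpace I p.1}
    (h : mvfderiv (coneModel I) (fun q ↦ mvfderiv I (extChartAt I p.1) q.1 (basePart q (τ q))) p (σ p)
      - mvfderiv (coneModel I) (fun q ↦ mvfderiv I (extChartAt I p.1) q.1 (basePart q (σ q))) p (τ p)
      = mvfderiv I (extChartAt I p.1) p.1 v) :
    basePart p (mlieBracket (coneModel I) σ τ p) = v := by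
  have hf : ContMDiffAt I 𝓘(ℝ, E) ∞ (extChartAt I p.1) p.1 := contMDiffAt_extChartAt
  have hfd : ∀ᶠ q in 𝓝 p, MDifferentiableAt I 𝓘(ℝ, E) (extChartAt I p.1) q.1 := by
    refine continuousAt_fst.eventually (p := fun x ↦ MDifferentiableAt I 𝓘(ℝ, E) _ x) ?_
    filter_upwards [extChartAt_source_mem_nhds (I := I) p.1] with x hx
    exact mdifferentiableAt_extChartAt (by simpa using hx)
  have hfc : ContMDiffAt (coneModel I) 𝓘(ℝ, E) ∞ (fun q : Cone M ↦ extChartAt I p.1 q.1) p :=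
    hf.comp p contMDiffAt_fst
  have key : ∀ ρ : Π p : Cone M, TangentSpace (coneModel I) p,
      (fun q ↦ mvfderiv (coneModel I) (fun q : Cone M ↦ extChartAt I p.1 q.1) q (ρ q)) =ᶠ[𝓝 p]
        fun q ↦ mvfderiv I (extChartAt I p.1) q.1 (basePart q (ρ q)) := fun ρ ↦ by
    filter_upwards [hfd] with q hq
    exact mvfderiv_comp_fst hq _
  have := mvfderiv_mlieBracket hfc hσ hτ
  rw [mvfderiv_congr (key σ), mvfderiv_congr (key τ), h, mvfderiv_comp_fst hfd.self_of_nhds] at this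
  have hid : mfderiv I 𝓘(ℝ, E) (extChartAt I p.1) p.1 = ContinuousLinearMap.id ℝ E :=
    mfderiv_extChartAt_self
  simp only [mvfderiv, hid] at this
  exact this

lemma dsPart_mlieBracket {σ τ : Π p : Cone M, TangentSpace (coneModel I) p}
    (hσ : DiffFieldAt σ p) (hτ : DiffFieldAt τ p) :
    dsPart p (mlieBracket (coneModel I) σ τ p) =
      mvfderiv (coneModel I) (fun q ↦ dsPart q (τ q)) p (σ p)
      - mvfderiv (coneModel I) (fun q ↦ dsPart q (σ q)) p (τ p) :=
  mvfderiv_mlieBracket (contMDiff_height p) hσ hτ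

lemma mlieBracket_lift (hX : DiffFieldAt X p.1) (hY : DiffFieldAt Y p.1) :
    mlieBracket (coneModel I) (lift X) (lift Y) p = lift (mlieBracket I X Y) p := by
  have hf : ContMDiffAt I 𝓘(ℝ, E) ∞ (extChartAt I p.1) p.1 := contMDiffAt_extChartAt
  apply cone_ext
  · refine basePart_mlieBracket_eq hX.lift hY.lift ?_
    have h1 : ∀ {Z : Π x : M, TangentSpace I x} (q : Cone M), basePart q (HessianCone.lift Z q) = Z q.1 :=
      fun _ ↦ basePart_horVec _
    simp only [h1]
    rw [mvfderiv_comp_fst (f := fun x ↦ mvfderiv I (extChartAt I p.1) x (Y x))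
      (mdifferentiableAt_mvfderiv_apply hf (by norm_cast) hY),
      mvfderiv_comp_fst (f := fun x ↦ mvfderiv I (extChartAt I p.1) x (X x))
      (mdifferentiableAt_mvfderiv_apply hf (by norm_cast) hX), h1, h1]
    exact (mvfderiv_mlieBracket hf hX hY).symm
  · rw [dsPart_mlieBracket hX.lift hY.lift]
    have h1 : ∀ {Z : Π x : M, TangentSpace I x} (q : Cone M), dsPart q (HessianCone.lift Z q) = 0 :=
      fun _ ↦ dsPart_horVec _
    simp only [h1]
    simp [mvfderiv_const]

lemma mlieBracket_radialField_lift (lam : ℝ) (hX : DiffFieldAt X p.1) :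
    mlieBracket (coneModel I) (radialField lam) (lift X) p = 0 := by
  have hf : ContMDiffAt I 𝓘(ℝ, E) ∞ (extChartAt I p.1) p.1 := contMDiffAt_extChartAt
  have hρ := (smoothField_radialField (I := I) lam).diffFieldAt p
  have h1 : ∀ q : Cone M, basePart q (lift X q) = X q.1 := fun _ ↦ basePart_horVec _
  have h2 : ∀ q : Cone M, dsPart q (lift X q) = 0 := fun _ ↦ dsPart_horVec _
  apply cone_ext
  · refine basePart_mlieBracket_eq hρ hX.lift ?_
    simp only [h1, basePart_radialField]
    rw [mvfderiv_comp_fst (f := fun x ↦ mvfderiv I (extChartAt I p.1) x (X x))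
      (mdifferentiableAt_mvfderiv_apply hf (by norm_cast) hX), basePart_radialField]
    simp [mvfderiv_const]
  · rw [dsPart_mlieBracket hρ hX.lift]
    simp only [h2, dsPart_radialField]
    rw [mvfderiv_const, mvfderiv_fun_mul mdifferentiableAt_const
      ((contMDiff_height p).mdifferentiableAt (by simp))]
    simp [mvfderiv_const, mvfderiv_height, h2]

end Bracket

end Cone

/-! ### Local frames of lifts and the radial field -/

section Frame
variable {E : Type*} [NormedAddCommGroup E] [NormedSpace ℝ E]
  {H : Type*} [TopologicalSpace H] {I : ModelWithCorners ℝ E H}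
  {M : Type*} [TopologicalSpace M] [ChartedSpace H M] [IsManifold I ∞ M]
  {F : Type*} [NormedAddCommGroup F] [NormedSpace ℝ F]
  {X Y Z : Π x : M, TangentSpace I x} {p : Cone M} {lam : ℝ}
open VectorField Filter Topology

lemma contMDiffCovariantDerivative_of_apply [FiniteDimensional ℝ E] {nabla : AffineConnection I M}
    (h : ∀ (X Y : Π x : M, TangentSpace I x) (x : M), SmoothField X →
      ContMDiffAt I I.tangent ∞ (fun y ↦ (⟨y, Y y⟩ : TangentBundle I M)) x →
      ContMDiffAt I I.tangent ∞ (fun y ↦ (⟨y, nabla X y (Y y)⟩ : TangentBundle I M)) x) :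
    CovariantDerivative.ContMDiffCovariantDerivative nabla ∞ :=
  ⟨⟨fun {σ} hσ x _ ↦ (contMDiffAt_hom_section fun Y hY ↦
    h σ Y x (contMDiffOn_univ.1 hσ) hY).contMDiffWithinAt⟩⟩

variable [FiniteDimensional ℝ E] [T2Space M]

/-- Near a point of the cone, every smooth vector field is a sum of fields `a • lift Y` and
`b • radialField lam` with smooth coefficients. -/
lemma cone_field_induction {P : (Π p : Cone M, TangentSpace (coneModel I) p) → Prop}
    (hlam : lam ≠ 0)
    (lift_smul : ∀ (a : Cone M → ℝ) (Y : Π x : M, TangentSpace I x),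
      ContMDiff (coneModel I) 𝓘(ℝ) ∞ a → SmoothField Y → P (a • lift Y))
    (radial_smul : ∀ b : Cone M → ℝ, ContMDiff (coneModel I) 𝓘(ℝ) ∞ b → P (b • radialField lam))
    (add : ∀ σ τ, SmoothField σ → SmoothField τ → P σ → P τ → P (σ + τ))
    (congr : ∀ σ τ, SmoothField σ → SmoothField τ → σ =ᶠ[𝓝 p] τ → P σ → P τ)
    (τ : Π p : Cone M, TangentSpace (coneModel I) p) (hτ : SmoothField τ) : P τ := by
  let e := trivializationAt E (TangentSpace I : M → Type _) p.1
  have hp : p.1 ∈ e.baseSet := FiberBundle.mem_baseSet_trivializationAt' p.1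
  let B := Module.finBasis ℝ E
  choose Y hY hYe using fun i ↦ exists_smooth_eventuallyEq e.open_baseSet hp
    (e.contMDiffOn_localFrame_baseSet (I := I) ∞ B i)
  let A (i) (q : Cone M) : ℝ := B.coord i (e ⟨q.1, basePart q (τ q)⟩).2
  have hA : ∀ i, ∀ q : Cone M, q.1 ∈ e.baseSet → ContMDiffAt (coneModel I) 𝓘(ℝ) ∞ (A i) q := by
    intro i q hq
    have h1 := contMDiffAt_basePart (hτ q)
    have h2 : (⟨q.1, basePart q (τ q)⟩ : TangentBundle I M) ∈ e.source := e.mem_source.2 hq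
    have h3 := ((e.contMDiffAt_iff
      (f := fun q : Cone M ↦ (⟨q.1, basePart q (τ q)⟩ : TangentBundle I M)) h2).1 h1).2
    exact ((B.coord i).toContinuousLinearMap.contMDiff _).comp q h3
  -- The coefficients `A i` are smooth only over the trivializing set and need a cutoff; the radial
  -- coefficient is smooth on the whole cone.
  obtain ⟨ψ, -, hψ⟩ := (SmoothBumpFunction.nhds_basis_tsupport (I := coneModel I) p).mem_iff.1
    ((e.open_baseSet.preimage continuous_fst).mem_nhds hp)
  have ha : ∀ i, ContMDiff (coneModel I) 𝓘(ℝ) ∞ fun q ↦ ψ q * A i q := fun i ↦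
    contMDiff_of_tsupport fun q hq ↦ ψ.contMDiffAt.mul
      (hA i q (hψ (tsupport_mul_subset_left hq)))
  have hb : ContMDiff (coneModel I) 𝓘(ℝ) ∞ fun q ↦ dsPart q (τ q) / (lam * height q) := fun q ↦
    (contMDiffAt_dsPart (by simp) (hτ q)).div₀ (contMDiffAt_const.mul (contMDiff_height q))
      (mul_ne_zero hlam (height_pos q).ne')
  have hs : SmoothField (∑ i, (fun q ↦ ψ q * A i q) • lift (Y i)) ∧
      P (∑ i, (fun q ↦ ψ q * A i q) • lift (Y i)) := by
    refine Finset.sum_induction _ (fun σ ↦ SmoothField σ ∧ P σ)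
      (fun σ τ h h' ↦ ⟨h.1.add h'.1, add σ τ h.1 h'.1 h.2 h'.2⟩) ?_
      fun i _ ↦ ⟨(hY i).lift.smul (ha i), lift_smul _ _ (ha i) (hY i)⟩
    -- The empty sum must satisfy P as well; the zero field counts as a multiple of the radial
    -- field.
    have h0 : (0 : Π p : Cone M, TangentSpace (coneModel I) p)
        = (fun _ : Cone M ↦ (0 : ℝ)) • radialField lam := by ext q : 1; simp
    rw [h0]
    exact ⟨(smoothField_radialField lam).smul contMDiff_const, radial_smul _ contMDiff_const⟩
  have hr := (smoothField_radialField (I := I) (M := M) lam).smul hb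
  refine congr _ _ (hs.1.add hr) hτ ?_ (add _ _ hs.1 hr hs.2 (radial_smul _ hb))
  have hev : ∀ᶠ q : Cone M in 𝓝 p, ∀ i, Y i q.1 = e.localFrame B i q.1 :=
    continuousAt_fst.eventually (p := fun x ↦ ∀ i, Y i x = e.localFrame B i x)
      (eventually_all.2 fun i ↦ hYe i)
  filter_upwards [hev, ψ.eventuallyEq_one,
    (e.open_baseSet.preimage continuous_fst).mem_nhds hp] with q h1 h2 h3
  have h3' : q.1 ∈ e.baseSet := h3
  rw [cone_decomp hlam (τ q)]
  simp only [Pi.add_apply, Finset.sum_apply, Pi.smul_apply', h2, Pi.one_apply, one_mul]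
  congr 1
  have h4 : basePart q (τ q) = ∑ i, A i q • Y i q.1 := by
    have := (e.basisAt B h3').sum_repr (basePart q (τ q))
    rw [← this]
    refine Finset.sum_congr rfl fun i _ ↦ ?_
    rw [h1, e.localFrame_apply_of_mem_baseSet B h3']
    congr 1
  rw [h4]
  exact ((map_sum (horVecL q) _ _).trans (Finset.sum_congr rfl fun i _ ↦ horVec_smul _ _)).symm

end Frame

/-! ### Smoothness and torsion of the cone connection -/

section ConeConnection
variable {E : Type*} [NormedAddCommGroup E] [NormedSpace ℝ E]
  {H : Type*} [TopologicalSpace H] {I : ModelWithCorners ℝ E H}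
  {M : Type*} [TopologicalSpace M] [ChartedSpace H M] [IsManifold I ∞ M]
  {F : Type*} [NormedAddCommGroup F] [NormedSpace ℝ F]
  {X Y Z : Π x : M, TangentSpace I x} {p : Cone M} {lam c : ℝ}
  {gM : SmoothMetric I M} {D : AffineConnection I M}
  {nabla : AffineConnection (coneModel I) (Cone M)}
  {σ τ : Π p : Cone M, TangentSpace (coneModel I) p}
open VectorField Filter Topology

lemma contMDiffAt_horVec {V : Π q : Cone M, TangentSpace I q.1} {n : ℕ∞ω} (hn : n ≤ ∞)
    (hV : ContMDiffAt (coneModel I) I.tangent n (fun q ↦ (⟨q.1, V q⟩ : TangentBundle I M)) p) :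
    ContMDiffAt (coneModel I) (coneModel I).tangent n
      (fun q ↦ (⟨q, horVec q (V q)⟩ : TangentBundle (coneModel I) (Cone M))) p :=
  ((contMDiff_equivTangentBundleProd_symm (n := ∞) (I := I) (I' := 𝓘(ℝ)) (M := M)
    (M' := PosReal)).of_le hn).contMDiffAt.comp p
    (hV.prodMk ((contMDiff_zero_posReal.of_le hn p.2).comp p contMDiffAt_snd))

lemma contMDiffAt_metric_comp_fst {V W : Π q : Cone M, TangentSpace I q.1}
    (hV : ContMDiffAt (coneModel I) I.tangent ∞ (fun q ↦ (⟨q.1, V q⟩ : TangentBundle I M)) p)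
    (hW : ContMDiffAt (coneModel I) I.tangent ∞ (fun q ↦ (⟨q.1, W q⟩ : TangentBundle I M)) p) :
    ContMDiffAt (coneModel I) 𝓘(ℝ) ∞ (fun q ↦ gM.inner q.1 (V q) (W q)) p := by
  have h := ContMDiffAt.clm_bundle_apply₂ (E₃ := Bundle.Trivial M ℝ) (F₃ := ℝ)
    ((gM.contMDiff p.1).comp p contMDiffAt_fst) hV hW
  exact ((contMDiffAt_totalSpace).1 h).2

namespace IsConeConnection

lemma nabla_lift (h : IsConeConnection gM D c lam nabla) (hlam : lam ≠ 0)
    (hY : DiffFieldAt Y p.1) (w : TangentSpace (coneModel I) p) :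
    nabla (lift Y) p w = horVec p (D Y p.1 (basePart p w))
      + (-(c * gM.inner p.1 (basePart p w) (Y p.1))) • radialField lam p
      + (dsPart p w / (lam * height p)) • lift Y p := by
  conv_lhs => rw [cone_decomp hlam w]
  rw [map_add, map_smul, h.gauss p _ Y hY, h.rho_hor p Y hY]
  module

lemma nabla_radialField (h : IsConeConnection gM D c lam nabla) (hlam : lam ≠ 0)
    (w : TangentSpace (coneModel I) p) : nabla (radialField lam) p w = w := by
  conv_lhs => rw [cone_decomp hlam w]
  rw [map_add, map_smul, h.hor_rho, h.rho_rho]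
  exact (cone_decomp hlam w).symm

variable [FiniteDimensional ℝ E] [T2Space M]

lemma smooth (h : IsConeConnection gM D c lam nabla) (hlam : lam ≠ 0)
    (hD : CovariantDerivative.ContMDiffCovariantDerivative D ∞) :
    CovariantDerivative.ContMDiffCovariantDerivative nabla ∞ := by
  refine contMDiffCovariantDerivative_of_apply fun σ τ p hσ hτ ↦ ?_
  have hb := contMDiffAt_basePart hτ
  have hd := contMDiffAt_dsPart (by simp) hτ
  have hh : ContMDiffAt (coneModel I) 𝓘(ℝ) ∞ (fun q : Cone M ↦ lam * height q) p :=
    contMDiffAt_const.mul (contMDiff_height p)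
  have hsmul : ∀ {a : Cone M → ℝ} {σ : Π p : Cone M, TangentSpace (coneModel I) p},
      ContMDiff (coneModel I) 𝓘(ℝ) ∞ a → SmoothField σ →
      ContMDiffAt (coneModel I) (coneModel I).tangent ∞ (fun q ↦
        (⟨q, nabla σ q (τ q)⟩ : TangentBundle (coneModel I) (Cone M))) p →
      ContMDiffAt (coneModel I) (coneModel I).tangent ∞ (fun q ↦
        (⟨q, nabla (a • σ) q (τ q)⟩ : TangentBundle (coneModel I) (Cone M))) p := by
    intro a σ ha hσ hn
    have h1 : (fun q ↦ nabla (a • σ) q (τ q))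
        = (fun q ↦ a q • nabla σ q (τ q) + mvfderiv (coneModel I) a q (τ q) • σ q) := by
      ext q : 1
      exact nabla_smul (hσ.diffFieldAt q) ((ha q).mdifferentiableAt (by simp)) _
    have h2 := ((ha p).smul_section hn).add_section
      ((contMDiffAt_mvfderiv_apply (ha p) (by simp) hτ).smul_section (hσ p))
    exact h2.congr_of_eventuallyEq (.of_forall fun q ↦ by simp [congrFun h1 q])
  refine cone_field_induction (p := p) (P := fun σ ↦
    ContMDiffAt (coneModel I) (coneModel I).tangent ∞ (fun q ↦
      (⟨q, nabla σ q (τ q)⟩ : TangentBundle (coneModel I) (Cone M))) p) hlam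
    (fun a Y ha hY ↦ ?_) (fun b hb ↦ ?_) (fun σ σ' hσ hσ' h1 h2 ↦ ?_)
    (fun σ σ' hσ hσ' he h1 ↦ ?_) σ hσ
  · refine hsmul ha hY.lift ?_
    have h1 : ∀ q, nabla (lift Y) q (τ q) = _ := fun q ↦
      h.nabla_lift hlam (hY.diffFieldAt q.1) (τ q)
    simp only [h1]
    have hY' : ContMDiffAt (coneModel I) I.tangent ∞
        (fun q : Cone M ↦ (⟨q.1, Y q.1⟩ : TangentBundle I M)) p := (hY p.1).comp p contMDiffAt_fst
    have h2 : ContMDiffAt (coneModel I) I.tangent ∞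
        (fun q : Cone M ↦ (⟨q.1, D Y q.1 (basePart q (τ q))⟩ : TangentBundle I M)) p :=
      ((contMDiff_nabla hD hY p.1).comp p contMDiffAt_fst).clm_bundle_apply hb
    exact ((contMDiffAt_horVec le_rfl h2).add_section
      (((contMDiffAt_const.mul (contMDiffAt_metric_comp_fst hb hY')).neg).smul_section
        (smoothField_radialField lam p))).add_section
      ((hd.div₀ hh (mul_ne_zero hlam (height_pos p).ne')).smul_section (hY.lift p))
  · refine hsmul hb (smoothField_radialField lam) ?_
    simpa only [h.nabla_radialField hlam] using hτ
  · refine (h1.add_section h2).congr_of_eventuallyEq (.of_forall fun q ↦ ?_)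
    exact congrArg (TotalSpace.mk q) (nabla_add (hσ.diffFieldAt q) (hσ'.diffFieldAt q) _)
  · refine h1.congr_of_eventuallyEq ?_
    filter_upwards [he.eventuallyEq_nhds] with q hq
    rw [nabla_congr (hσ.diffFieldAt q) (hσ'.diffFieldAt q) hq]

end IsConeConnection

/-- A tensorial operation vanishing on all `lift Y` and on the radial field vanishes. -/
lemma _root_.TensorialAt.eq_zero_of_lift_of_radialField [FiniteDimensional ℝ E] [T2Space M]
    {A : Type*} [AddCommGroup A] [Module ℝ A] [TopologicalSpace A] [ContinuousAdd A]
    [ContinuousSMul ℝ A]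
    {Φ : (Π q : Cone M, TangentSpace (coneModel I) q) → A}
    (hΦ : TensorialAt (coneModel I) (E × ℝ) Φ p) (hlam : lam ≠ 0)
    (h1 : ∀ Y : Π x : M, TangentSpace I x, SmoothField Y → Φ (lift Y) = 0)
    (h2 : Φ (radialField lam) = 0) (hσ : DiffFieldAt σ p) : Φ σ = 0 := by
  obtain ⟨Y, hY, hYp⟩ := exists_smoothField_eq (basePart p (σ p))
  have hY' := hY.lift.diffFieldAt p
  have hρ := (smoothField_radialField (I := I) (M := M) lam).diffFieldAt p
  -- By tensoriality only the value of σ at p matters, so a constant coefficient suffices.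
  set b : Cone M → ℝ := fun _ ↦ dsPart p (σ p) / (lam * height p) with hb
  have hbd : MDifferentiableAt (coneModel I) 𝓘(ℝ) b p := mdifferentiableAt_const
  rw [hΦ.pointwise hσ (hY'.add (hρ.smul hbd)), hΦ.add hY' (hρ.smul hbd), hΦ.smul hbd hρ, h1 Y hY, h2,
    smul_zero, add_zero]
  refine (cone_decomp hlam (σ p)).trans ?_
  rw [← hYp]
  rfl

namespace IsConeConnection
variable [FiniteDimensional ℝ E] [T2Space M] [I.Boundaryless]

/-- The torsion is a tensor. On two lifts its horizontal part is the torsion of D and its radial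
part cancels by symmetry of g_M; on ρ and a lift X it is X - X - [ρ, X] = 0. -/
lemma isTorsionFree (h : IsConeConnection gM D c lam nabla) (hlam : lam ≠ 0)
    (hD : IsTorsionFree D) : IsTorsionFree nabla := by
  intro σ τ hσ hτ p
  have hρ := (smoothField_radialField (I := I) (M := M) lam).diffFieldAt p
  rw [← sub_eq_zero, ← nabla.torsion_apply (hσ.diffFieldAt p) (hτ.diffFieldAt p)]
  have key : ∀ X : Π x : M, TangentSpace I x, SmoothField X →
      nabla.torsion p (radialField lam p) (lift X p) = 0 := fun X hX ↦ by
    have hX' := hX.diffFieldAt p.1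
    rw [nabla.torsion_apply hρ hX'.lift, mlieBracket_radialField_lift _ hX', h.rho_hor _ _ hX',
      h.nabla_radialField hlam, sub_self, sub_zero]
  obtain ⟨X, hX, hXp⟩ := exists_smoothField_eq (basePart p (σ p))
  obtain ⟨Y, hY, hYp⟩ := exists_smoothField_eq (basePart p (τ p))
  rw [cone_decomp hlam (σ p), cone_decomp hlam (τ p), ← hXp, ← hYp]
  have hX' := hX.diffFieldAt p.1
  have hY' := hY.diffFieldAt p.1
  have h1 : nabla.torsion p (lift X p) (lift Y p) = 0 := by
    rw [nabla.torsion_apply hX'.lift hY'.lift, mlieBracket_lift hX' hY', lift, lift,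
      h.gauss p _ _ hX', h.gauss p _ _ hY', HessianCone.lift, ← hD X Y hX hY, gM.symm, horVec_sub]
    module
  have h2 : nabla.torsion p (horVec p (X p.1)) (horVec p (Y p.1)) = 0 := h1
  have h3 : nabla.torsion p (horVec p (X p.1)) (radialField lam p) = 0 := by
    rw [nabla.torsion_antisymm]
    simpa using! key X hX
  have h4 : nabla.torsion p (radialField lam p) (horVec p (Y p.1)) = 0 := key Y hY
  simp [h2, h3, h4, nabla.torsion_self]

end IsConeConnection
end ConeConnection

/-! ### The cone connection is flat and the cone metric is Hessian -/

section ConeHessian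
variable {E : Type*} [NormedAddCommGroup E] [NormedSpace ℝ E]
  {H : Type*} [TopologicalSpace H] {I : ModelWithCorners ℝ E H}
  {M : Type*} [TopologicalSpace M] [ChartedSpace H M] [IsManifold I ∞ M]
  {X Y Z : Π x : M, TangentSpace I x} {p : Cone M} {lam c : ℝ}
  {gM : SmoothMetric I M} {D : AffineConnection I M}
  {nabla : AffineConnection (coneModel I) (Cone M)}
  {σ τ : Π p : Cone M, TangentSpace (coneModel I) p}
open VectorField Filter Topology

lemma tensorialAt_hess [FiniteDimensional ℝ E] [I.Boundaryless] {nabla : AffineConnection I M}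
    {φ : M → ℝ} {x : M}
    (hφ : ContMDiffAt I 𝓘(ℝ) ∞ φ x) (v : TangentSpace I x) :
    TensorialAt I E (fun Y ↦ hess nabla φ Y x v) x where
  smul {f Y} hf hY := by
    have h1 : (fun y ↦ mvfderiv I φ y ((f • Y) y)) = fun y ↦ f y * mvfderiv I φ y (Y y) := by
      ext y; simp
    have h2 := mdifferentiableAt_mvfderiv_apply hφ (by norm_cast) hY
    simp only [hess, h1]
    rw [mvfderiv_fun_mul hf h2, nabla_smul hY hf]
    simp
    ring
  add {Y Y'} hY hY' := by
    have h1 : (fun y ↦ mvfderiv I φ y ((Y + Y') y)) =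
        (fun y ↦ mvfderiv I φ y (Y y)) + fun y ↦ mvfderiv I φ y (Y' y) := by
      ext y; simp
    have h2 := mdifferentiableAt_mvfderiv_apply hφ (by norm_cast) hY
    have h3 := mdifferentiableAt_mvfderiv_apply hφ (by norm_cast) hY'
    simp only [hess, h1]
    rw [mvfderiv_add h2 h3, nabla_add hY hY']
    simp
    ring

lemma mvfderiv_height_sq (w : TangentSpace (coneModel I) p) (k : ℝ) :
    mvfderiv (coneModel I) (fun q : Cone M ↦ k * (height q * height q)) p w
      = 2 * k * height p * dsPart p w := by
  have h := (contMDiff_height (I := I) p).mdifferentiableAt (by simp)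
  have h2 : MDifferentiableAt (coneModel I) 𝓘(ℝ) (fun q : Cone M ↦ height q * height q) p := h.mul h
  rw [mvfderiv_fun_mul mdifferentiableAt_const h2, mvfderiv_const, mvfderiv_fun_mul h h]
  simp [mvfderiv_height]
  ring

namespace IsConeConnection
variable [FiniteDimensional ℝ E] [T2Space M] [I.Boundaryless]

lemma isHessianMetric (h : IsConeConnection gM D c lam nabla) (hlam : lam ≠ 0) (hlam' : lam ≠ 1 / 2)
    (hc : (2 * lam - 1) / lam ^ 2 = c) {g : SmoothMetric (coneModel I) (Cone M)}
    (hg : IsConeMetric gM g) : IsHessianMetric nabla g := by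
  have h2 : 2 * lam - 1 ≠ 0 := fun h ↦ hlam' (by linarith)
  intro p₀
  -- For φ = k s² one has ρφ = 2λφ, so Hess φ(v, ρ) = (2λ - 1) vφ = 2k(2λ - 1) s ds(v). Equating
  -- this with g(v, ρ) = λ s ds(v) fixes k. The horizontal directions then agree exactly because c =
  -- (2λ - 1)/λ².
  set k := lam / (2 * (2 * lam - 1)) with hk
  have hk' : 2 * k * (2 * lam - 1) = lam := by
    rw [hk]
    field_simp
  have hφ : ContMDiff (coneModel I) 𝓘(ℝ) ∞ (fun q : Cone M ↦ k * (height q * height q)) :=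
    contMDiff_const.mul (contMDiff_height.mul contMDiff_height)
  refine ⟨Set.univ, isOpen_univ, Set.mem_univ _, _, hφ.contMDiffOn, fun p _ v σ hσ ↦ ?_⟩
  have hp := (height_pos p).ne'
  have hpv : ((p.2 : ℝ)) = height p := rfl
  have hh := (contMDiff_height (I := I) p).mdifferentiableAt (by simp)
  have hT := tensorialAt_hess (nabla := nabla) (hφ p) v
  rw [← sub_eq_zero]
  refine TensorialAt.eq_zero_of_lift_of_radialField (p := p) (lam := lam)
    (Φ := fun σ ↦ g.inner p v (σ p) - hess nabla _ σ p v) ⟨fun {f σ} hf hσ ↦ ?_, fun {σ σ'} hσ hσ' ↦ ?_⟩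
    hlam (fun Y hY ↦ ?_) ?_ hσ
  · rw [hT.smul hf hσ]; simp; ring
  · rw [hT.add hσ hσ']; simp; ring
  · have h3 : ∀ q : Cone M, dsPart q (lift Y q) = 0 := fun q ↦ dsPart_horVec _
    have h4 : basePart p (lift Y p) = Y p.1 := basePart_horVec _
    rw [hess, h.nabla_lift hlam (hY.diffFieldAt _)]
    simp only [mvfderiv_height_sq, h3, dsPart_add, dsPart_smul, dsPart_horVec, dsPart_radialField,
      hg p, h4, hpv, mul_zero, mvfderiv_const, ← hc]
    simp
    rw [hk]
    field_simp
    ring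
  · have h3 : ∀ q : Cone M, dsPart q (radialField (I := I) lam q) = lam * height q :=
      fun q ↦ dsPart_radialField
    have h5 : (fun q : Cone M ↦ 2 * k * height q * dsPart q (radialField (I := I) lam q))
        = fun q ↦ (2 * k * lam) * (height q * height q) := by
      ext q; rw [h3]; ring
    rw [hess, h.nabla_radialField hlam]
    simp only [mvfderiv_height_sq]
    rw [h5, mvfderiv_height_sq, hg p, h3, basePart_radialField]
    simp
    linear_combination (-(height p * dsPart p v)) * hk'

lemma nabla_lift_lift (h : IsConeConnection gM D c lam nabla) (hZ : SmoothField Z) :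
    (fun q : Cone M ↦ nabla (lift Z) q (lift Y q)) =
      lift (fun x ↦ D Z x (Y x))
        + (fun q : Cone M ↦ -(c * gM.inner q.1 (Y q.1) (Z q.1))) • radialField lam := by
  ext q : 1
  refine (h.gauss q (Y q.1) Z (hZ.diffFieldAt _)).trans ?_
  rw [sub_eq_add_neg, ← neg_smul]
  rfl

lemma mvfderiv_metric_lift (hY : SmoothField Y) (hZ : SmoothField Z)
    (w : TangentSpace (coneModel I) p) :
    MDifferentiableAt (coneModel I) 𝓘(ℝ) (fun q : Cone M ↦ -(c * gM.inner q.1 (Y q.1) (Z q.1))) p ∧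
    mvfderiv (coneModel I) (fun q : Cone M ↦ -(c * gM.inner q.1 (Y q.1) (Z q.1))) p w
      = -(c * mvfderiv I (fun x ↦ gM.inner x (Y x) (Z x)) p.1 (basePart p w)) := by
  have h1 := mdifferentiableAt_metric_apply gM (hY.diffFieldAt p.1) (hZ.diffFieldAt p.1)
  have h2 : MDifferentiableAt I 𝓘(ℝ) (fun x ↦ -c * gM.inner x (Y x) (Z x)) p.1 :=
    mdifferentiableAt_const.mul h1
  have h3 : (fun q : Cone M ↦ -(c * gM.inner q.1 (Y q.1) (Z q.1))) =
      fun q : Cone M ↦ -c * gM.inner q.1 (Y q.1) (Z q.1) := by ext q; ring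
  rw [h3]
  refine ⟨h2.comp p mdifferentiableAt_fst, ?_⟩
  rw [mvfderiv_comp_fst h2, mvfderiv_fun_mul mdifferentiableAt_const h1, mvfderiv_const]
  simp

/-- Differentiating the term -c g_M(Y, Z) ρ produces -c g_M(Y, Z) w since ∇_w ρ = w.
Antisymmetrized, this is the term that matches curvature c of D. -/
lemma nabla_nabla_lift_lift (h : IsConeConnection gM D c lam nabla) (hlam : lam ≠ 0)
    (hD : CovariantDerivative.ContMDiffCovariantDerivative D ∞)
    (hY : SmoothField Y) (hZ : SmoothField Z) (w : TangentSpace (coneModel I) p) :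
    nabla (fun q : Cone M ↦ nabla (lift Z) q (lift Y q)) p w =
      nabla (lift (fun x ↦ D Z x (Y x))) p w + (-(c * gM.inner p.1 (Y p.1) (Z p.1))) • w
      + (-(c * mvfderiv I (fun x ↦ gM.inner x (Y x) (Z x)) p.1 (basePart p w))) •
        radialField lam p := by
  obtain ⟨h1, h2⟩ := mvfderiv_metric_lift (gM := gM) (c := c) hY hZ w
  have hρ := (smoothField_radialField (I := I) (M := M) lam).diffFieldAt p
  rw [h.nabla_lift_lift hZ, nabla_add ((smoothField_nabla hD hZ hY).lift.diffFieldAt p) (hρ.smul h1),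
    nabla_smul hρ h1, h2, h.nabla_radialField hlam, add_assoc]

lemma curvature_radialField_lift_lift (h : IsConeConnection gM D c lam nabla) (hlam : lam ≠ 0)
    (hD : CovariantDerivative.ContMDiffCovariantDerivative D ∞)
    (hX : SmoothField X) (hZ : SmoothField Z) :
    curvature nabla (radialField lam) (lift X) (lift Z) p = 0 := by
  have h1 : (fun q : Cone M ↦ nabla (lift Z) q (radialField lam q)) = lift Z := by
    ext q : 1
    exact h.rho_hor q Z (hZ.diffFieldAt _)
  have h2 : nabla (lift Z) p (lift X p) = _ := congrFun (h.nabla_lift_lift hZ) p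
  rw [curvature, h1, h.nabla_nabla_lift_lift hlam hD hX hZ,
    mlieBracket_radialField_lift _ (hX.diffFieldAt _), map_zero, h2,
    h.rho_hor p _ ((smoothField_nabla hD hZ hX).diffFieldAt _), basePart_radialField]
  simp

/-- The horizontal part vanishes by the curvature equation of D (`h6`); the radial part is the
Codazzi equation combined with torsion-freeness of D (`h7`). -/
lemma curvature_lift_lift_lift (h : IsConeConnection gM D c lam nabla) (hlam : lam ≠ 0)
    (hD : IsStatisticalOfConstCurvature D gM c)
    (hX : SmoothField X) (hY : SmoothField Y) (hZ : SmoothField Z) :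
    curvature nabla (lift X) (lift Y) (lift Z) p = 0 := by
  have hs := hD.statistical.smooth
  have h1 := hD.curvature_eq X Y Z hX hY hZ p.1
  have h2 := hD.statistical.symm_left X Y Z hX hY hZ p.1
  have h3 := hD.statistical.torsion_free X Y hX hY p.1
  have h4 : ∀ {W V : Π x : M, TangentSpace I x}, SmoothField W →
      nabla (lift W) p (horVec p (V p.1)) = horVec p (D W p.1 (V p.1))
        - (c * gM.inner p.1 (V p.1) (W p.1)) • radialField lam p :=
    fun hW ↦ h.gauss p _ _ (hW.diffFieldAt _)
  rw [curvature, h.nabla_nabla_lift_lift hlam hs hY hZ, h.nabla_nabla_lift_lift hlam hs hX hZ,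
    mlieBracket_lift (hX.diffFieldAt _) (hY.diffFieldAt _)]
  simp only [lift, basePart_horVec]
  rw [h4 (smoothField_nabla hs hZ hY), h4 (smoothField_nabla hs hZ hX), h4 hZ]
  simp only [curvature] at h1
  simp only [covDerivMetric] at h2
  have h5 := congrArg (fun v ↦ gM.inner p.1 v (Z p.1)) h3
  simp only [map_sub, sub_apply] at h5
  have h6 := congrArg (horVec p) h1
  simp only [horVec_sub, horVec_smul] at h6
  have h7 : gM.inner p.1 (X p.1) (D Z p.1 (Y p.1)) + mvfderiv I (fun x ↦ gM.inner x (Y x) (Z x)) p.1 (X p.1)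
    - gM.inner p.1 (Y p.1) (D Z p.1 (X p.1)) - mvfderiv I (fun x ↦ gM.inner x (X x) (Z x)) p.1 (Y p.1)
    - gM.inner p.1 (mlieBracket I X Y p.1) (Z p.1) = 0 := by linarith
  have h8 := congrArg (fun t : ℝ ↦ (c * t) • radialField (I := I) lam p) h7
  simp only [mul_zero, zero_smul] at h8
  linear_combination (norm := module) h6 - h8

lemma isFlat (h : IsConeConnection gM D c lam nabla) (hlam : lam ≠ 0)
    (hD : IsStatisticalOfConstCurvature D gM c) : IsFlat nabla := by
  intro σ₁ σ₂ σ h₁ h₂ hσ p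
  have hs := h.smooth hlam hD.statistical.smooth
  have hρ := smoothField_radialField (I := I) (M := M) lam
  refine cone_field_induction (p := p) (P := fun σ ↦ curvature nabla σ₁ σ₂ σ p = 0) hlam
    (fun a Z ha hZ ↦ ?_) (fun b hb ↦ ?_) (fun σ σ' hσ hσ' h1 h2 ↦ ?_)
    (fun σ σ' hσ hσ' he h1 ↦ ?_) σ hσ
  · rw [curvature_smul_right ha hs (h₁.diffFieldAt p) (h₂.diffFieldAt p) hZ.lift]
    have key : curvature nabla σ₁ σ₂ (lift Z) p = 0 := by
      refine (tensorialAt_curvature hs hZ.lift).eq_zero_of_lift_of_radialField hlam (fun X hX ↦ ?_) ?_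
        (h₁.diffFieldAt p)
      · rw [curvature_swap, neg_eq_zero]
        refine (tensorialAt_curvature hs hZ.lift).eq_zero_of_lift_of_radialField hlam
          (fun Y hY ↦ ?_) ?_ (h₂.diffFieldAt p)
        · exact h.curvature_lift_lift_lift hlam hD hY hX hZ
        · exact h.curvature_radialField_lift_lift hlam hD.statistical.smooth hX hZ
      · rw [curvature_swap, neg_eq_zero]
        refine (tensorialAt_curvature hs hZ.lift).eq_zero_of_lift_of_radialField hlam
          (fun Y hY ↦ ?_) ?_ (h₂.diffFieldAt p)
        · rw [curvature_swap, neg_eq_zero]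
          exact h.curvature_radialField_lift_lift hlam hD.statistical.smooth hY hZ
        · simp [curvature]
    rw [key, smul_zero]
  -- As ∇ρ = Id, the curvature applied to ρ is ∇_σ₁ σ₂ - ∇_σ₂ σ₁ - [σ₁, σ₂], the torsion.
  · rw [curvature_smul_right hb hs (h₁.diffFieldAt p) (h₂.diffFieldAt p) hρ]
    simp only [curvature, h.nabla_radialField hlam]
    rw [h.isTorsionFree hlam hD.statistical.torsion_free σ₁ σ₂ h₁ h₂, sub_self, smul_zero]
  · rw [curvature_add_right hs (h₁.diffFieldAt p) (h₂.diffFieldAt p) hσ hσ', h1, h2, add_zero]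
  · rw [← curvature_congr_right hs (h₁.diffFieldAt p) (h₂.diffFieldAt p) hσ hσ' he, h1]

lemma isRadiant (h : IsConeConnection gM D c lam nabla) (hlam : lam ≠ 0)
    (hD : IsStatisticalOfConstCurvature D gM c) : IsRadiant nabla (radialField lam) where
  flat_affine :=
    ⟨h.smooth hlam hD.statistical.smooth, h.isTorsionFree hlam hD.statistical.torsion_free,
      h.isFlat hlam hD⟩
  smooth_field := smoothField_radialField lam
  nabla_rho _ w := h.nabla_radialField hlam w

lemma isHessianCone (h : IsConeConnection gM D c lam nabla) (hlam : lam ≠ 0) (hlam' : lam ≠ 1 / 2)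
    (hc : (2 * lam - 1) / lam ^ 2 = c) (hD : IsStatisticalOfConstCurvature D gM c)
    {g : SmoothMetric (coneModel I) (Cone M)} (hg : IsConeMetric gM g) :
    IsHessianCone gM nabla g where
  cone_metric := hg
  hessian := ⟨(h.isRadiant hlam hD).flat_affine, h.isHessianMetric hlam hlam' hc hg⟩
  radiant := ⟨lam, hlam, hlam', h.isRadiant hlam hD⟩

end IsConeConnection
end ConeHessian

/-! ### Existence of the cone metric and of the cone connection -/

section ConeMetric
variable {E : Type*} [NormedAddCommGroup E] [NormedSpace ℝ E]
  {H : Type*} [TopologicalSpace H] {I : ModelWithCorners ℝ E H}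
  {M : Type*} [TopologicalSpace M] [ChartedSpace H M] [IsManifold I ∞ M]
  {X Y Z : Π x : M, TangentSpace I x} {p : Cone M} {lam c : ℝ}
  {gM : SmoothMetric I M} {D : AffineConnection I M}
  {nabla : AffineConnection (coneModel I) (Cone M)}
  {σ τ : Π p : Cone M, TangentSpace (coneModel I) p}
open VectorField Filter Topology

/-- The differential of the coordinate `s`. -/
def dsPartL (p : Cone M) : TangentSpace (coneModel I) p →L[ℝ] ℝ := mvfderiv (coneModel I) height p

lemma horVecL_apply (v : TangentSpace I p.1) : horVecL p v = horVec p v := rfl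

@[simp] lemma horVec_zero : horVec p (0 : TangentSpace I p.1) = 0 := map_zero (horVecL p)

section Metric
variable [FiniteDimensional ℝ E]

variable (gM) in
/-- The bilinear form `s² g_M + ds²`. -/
def coneInner (p : Cone M) :
    TangentSpace (coneModel I) p →L[ℝ] TangentSpace (coneModel I) p →L[ℝ] ℝ :=
  haveI : FiniteDimensional ℝ (TangentSpace (coneModel I) p) :=
    inferInstanceAs (FiniteDimensional ℝ (E × ℝ))
  haveI : T2Space (TangentSpace (coneModel I) p) := inferInstanceAs (T2Space (E × ℝ))
  LinearMap.toContinuousLinearMap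
    { toFun := fun w ↦ height p ^ 2 • (gM.inner p.1 (basePart p w)).comp (basePartL p)
        + dsPart p w • dsPartL p
      map_add' := fun w w' ↦ by
        ext u
        simp [basePart_add, dsPart_add]
        ring
      map_smul' := fun a w ↦ by
        ext u
        simp [basePart_smul, dsPart_smul]
        ring }

lemma coneInner_apply (w w' : TangentSpace (coneModel I) p) :
    coneInner gM p w w' = height p ^ 2 * gM.inner p.1 (basePart p w) (basePart p w')
      + dsPart p w * dsPart p w' := rfl

/-- The unit ball lies in the sum of two bounded sets: the unit ball of g_M scaled by 1/s, and the
interval (-1, 1) times ∂/∂s, which is the radial field with constant 1/s at height s. -/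
lemma isVonNBounded_coneInner :
    Bornology.IsVonNBounded ℝ {w : TangentSpace (coneModel I) p | coneInner gM p w w < 1} := by
  have hp := height_pos p
  have h1 := (gM.isVonNBounded p.1).image
    (horVecL p ∘L ((height p)⁻¹ • ContinuousLinearMap.id ℝ (TangentSpace I p.1)))
  have h2 := (NormedSpace.isVonNBounded_ball ℝ ℝ 1).image
    (((ContinuousLinearMap.id ℝ ℝ).smulRight (radialField (I := I) (height p)⁻¹ p) :
      ℝ →L[ℝ] TangentSpace (coneModel I) p))
  refine (h1.add h2).subset fun w hw ↦ ?_
  rw [Set.mem_ofPred_eq, coneInner_apply] at hw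
  have hnn : ∀ u, 0 ≤ gM.inner p.1 u u := fun u ↦ by
    rcases eq_or_ne u 0 with rfl | hu
    · simp
    · exact (gM.pos p.1 u hu).le
  have h3 := mul_nonneg (sq_nonneg (height p)) (hnn (basePart p w))
  refine Set.mem_add.2 ⟨_, ⟨height p • basePart p w, ?_, rfl⟩, _, ⟨dsPart p w, ?_, rfl⟩, ?_⟩
  · simp only [Set.mem_ofPred_eq, map_smul, smul_apply, smul_eq_mul]
    nlinarith [mul_self_nonneg (dsPart p w)]
  · rw [mem_ball_zero_iff, Real.norm_eq_abs, ← sq_lt_one_iff_abs_lt_one]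
    linarith [sq (dsPart p w)]
  · simp only [ContinuousLinearMap.comp_apply, smul_apply, ContinuousLinearMap.id_apply, smul_smul,
      inv_mul_cancel₀ hp.ne', one_smul, horVecL_apply, ContinuousLinearMap.smulRight_apply]
    rw [eq_comm]
    refine (cone_decomp (inv_ne_zero hp.ne') w).trans ?_
    rw [inv_mul_cancel₀ hp.ne', div_one]

lemma contMDiff_coneInner : ContMDiff (coneModel I)
    ((coneModel I).prod 𝓘(ℝ, (E × ℝ) →L[ℝ] (E × ℝ) →L[ℝ] ℝ)) ∞
    (fun p ↦ TotalSpace.mk' ((E × ℝ) →L[ℝ] (E × ℝ) →L[ℝ] ℝ)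
      (E := fun p : Cone M ↦
        TangentSpace (coneModel I) p →L[ℝ] TangentSpace (coneModel I) p →L[ℝ] ℝ)
      p (coneInner gM p)) := fun p ↦ by
  refine contMDiffAt_hom_section (W := fun p : Cone M ↦ TangentSpace (coneModel I) p →L[ℝ] ℝ)
    fun σ hσ ↦ contMDiffAt_hom_section (W := Bundle.Trivial (Cone M) ℝ) fun τ hτ ↦ ?_
  refine contMDiffAt_totalSpace.2 ⟨contMDiffAt_id, ?_⟩
  have h1 := contMDiffAt_metric_comp_fst (gM := gM) (contMDiffAt_basePart hσ)
    (contMDiffAt_basePart hτ)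
  exact (((contMDiff_height p).pow 2).mul h1).add
    ((contMDiffAt_dsPart (by simp) hσ).mul (contMDiffAt_dsPart (by simp) hτ))

lemma exists_isConeMetric (gM : SmoothMetric I M) :
    ∃ g : SmoothMetric (coneModel I) (Cone M), IsConeMetric gM g := by
  refine ⟨⟨coneInner gM, fun p w w' ↦ ?_, fun p w hw ↦ ?_, fun p ↦ isVonNBounded_coneInner,
    contMDiff_coneInner⟩, fun p w w' ↦ coneInner_apply w w'⟩
  · rw [coneInner_apply, coneInner_apply, gM.symm]
    ring
  · rw [coneInner_apply]
    have hp := height_pos p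
    by_cases hb : basePart p w = 0
    · have hd : dsPart p w ≠ 0 := fun hd ↦ hw (cone_ext (by simpa using hb) (by simpa using hd))
      rw [hb]
      simpa using mul_self_pos.2 hd
    · have := gM.pos p.1 _ hb
      have := mul_self_nonneg (dsPart p w)
      positivity

end Metric

section Connection

/-- The vector field on `M` induced on the slice at height `s`. -/
def slicePart (s : PosReal) (σ : Π p : Cone M, TangentSpace (coneModel I) p) (x : M) :
    TangentSpace I x :=
  basePart (x, s) (σ (x, s))

lemma DiffFieldAt.slicePart (hσ : DiffFieldAt σ p) : DiffFieldAt (slicePart p.2 σ) p.1 :=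
  MDifferentiableAt.comp (I' := coneModel I)
    (g := fun q ↦ (⟨q.1, basePart q (σ q)⟩ : TangentBundle I M)) (f := fun x ↦ ((x, p.2) : Cone M))
    p.1 (mdifferentiableAt_basePart hσ) (mdifferentiableAt_slice p.1 p.2)

variable (gM D c lam) in
/-- The cone connection, as a function. -/
def coneNabla (σ : Π p : Cone M, TangentSpace (coneModel I) p) (p : Cone M) :
    TangentSpace (coneModel I) p →L[ℝ] TangentSpace (coneModel I) p :=
  horVecL p ∘L D (slicePart p.2 σ) p.1 ∘L basePartL p
    + (dsPartL p).smulRight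
      ((lam * height p)⁻¹ • (mlieBracket (coneModel I) (radialField lam) σ p + σ p))
    + (dsPart p (σ p) / (lam * height p)) • (horVecL p ∘L basePartL p)
    + ((mvfderiv (coneModel I) (fun q ↦ dsPart q (σ q) / (lam * height q)) p ∘L horVecL p
        - c • gM.inner p.1 (basePart p (σ p))) ∘L basePartL p).smulRight (radialField lam p)

lemma coneNabla_apply (w : TangentSpace (coneModel I) p) :
    coneNabla lam c gM D σ p w = horVec p (D (slicePart p.2 σ) p.1 (basePart p w))
      + dsPart p w • ((lam * height p)⁻¹ •
        (mlieBracket (coneModel I) (radialField lam) σ p + σ p))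
      + (dsPart p (σ p) / (lam * height p)) • horVec p (basePart p w)
      + (mvfderiv (coneModel I) (fun q ↦ dsPart q (σ q) / (lam * height q)) p
          (horVec p (basePart p w))
        - c * gM.inner p.1 (basePart p (σ p)) (basePart p w)) • radialField lam p := rfl

lemma mdifferentiableAt_radial_coeff (hlam : lam ≠ 0) (hσ : DiffFieldAt σ p) :
    MDifferentiableAt (coneModel I) 𝓘(ℝ) (fun q ↦ dsPart q (σ q) / (lam * height q)) p := by
  have h1 : ContMDiffAt (coneModel I) 𝓘(ℝ) ∞ (fun q : Cone M ↦ (lam * height q)⁻¹) p :=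
    (contMDiffAt_const.mul (contMDiff_height p)).inv₀ (mul_ne_zero hlam (height_pos p).ne')
  exact (mdifferentiableAt_dsPart hσ).mul (h1.mdifferentiableAt (by simp))

variable [FiniteDimensional ℝ E]

/-- Write w = v + aρ and σ = Y + bρ with v, Y horizontal. The definition adds up D_v Y on the slice,
a ∇_ρ σ with ∇_ρ σ = [ρ, σ] + σ as forced by torsion-freeness and ∇ρ = Id, and b v + (v(b) - c
g_M(Y, v)) ρ. For the Leibniz rule, [ρ, fσ] supplies a ρ(f) σ, while D and the derivative of b
supply v(f) Y and v(f) b ρ, together v(f) σ. -/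
lemma isCovariantDerivativeOn_coneNabla (hlam : lam ≠ 0) :
    IsCovariantDerivativeOn (E × ℝ) (coneNabla lam c gM D) Set.univ where
  add {σ τ p} hσ hτ _ := by
    ext w : 1
    have h1 : slicePart p.2 (σ + τ) = slicePart p.2 σ + slicePart p.2 τ := by
      ext x; exact basePart_add _ _
    have h2 : (fun q : Cone M ↦ dsPart q ((σ + τ) q) / (lam * height q)) =
        (fun q ↦ dsPart q (σ q) / (lam * height q)) + fun q ↦ dsPart q (τ q) / (lam * height q) := by
      ext q; simp [dsPart_add, add_div]
    have hσ' : DiffFieldAt σ p := hσ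
    have hτ' : DiffFieldAt τ p := hτ
    rw [add_apply, coneNabla_apply, coneNabla_apply, coneNabla_apply, h1, h2,
      nabla_add hσ'.slicePart hτ'.slicePart, mlieBracket_add_right hσ hτ,
      mvfderiv_add (mdifferentiableAt_radial_coeff hlam hσ')
        (mdifferentiableAt_radial_coeff hlam hτ'), Pi.add_apply, dsPart_add, basePart_add,
      horVec_add, map_add, add_apply, add_apply, add_div]
    module
  leibniz {σ f p} hσ hf _ := by
    ext w : 1
    have hσ' : DiffFieldAt σ p := hσ
    have h1 : slicePart p.2 (f • σ) = (fun x ↦ f (x, p.2)) • slicePart p.2 σ := by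
      ext x; exact basePart_smul _ _
    have h2 : (fun q : Cone M ↦ dsPart q ((f • σ) q) / (lam * height q)) =
        fun q ↦ f q * (dsPart q (σ q) / (lam * height q)) := by
      ext q; simp [dsPart_smul, mul_div_assoc]
    have h3 : MDifferentiableAt I 𝓘(ℝ) (fun x ↦ f (x, p.2)) p.1 :=
      hf.comp p.1 (mdifferentiableAt_slice p.1 p.2)
    have h4 : σ p = horVec p (slicePart p.2 σ p.1)
      + (dsPart p (σ p) / (lam * height p)) • radialField lam p := cone_decomp hlam (σ p)
    have h5 : mvfderiv (coneModel I) f p w = mvfderiv (coneModel I) f p (horVec p (basePart p w))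
        + (dsPart p w / (lam * height p)) * mvfderiv (coneModel I) f p (radialField lam p) := by
      conv_lhs => rw [cone_decomp hlam w]
      simp
    rw [add_apply, smul_apply, ContinuousLinearMap.smulRight_apply, coneNabla_apply,
      coneNabla_apply, h1, h2, nabla_smul hσ'.slicePart h3, mvfderiv_slice hf,
      mlieBracket_smul_right hf hσ, mvfderiv_fun_mul hf (mdifferentiableAt_radial_coeff hlam hσ'),
      Pi.smul_apply', dsPart_smul, basePart_smul, horVec_add, horVec_smul, horVec_smul, map_smul,
      h5]
    have h6 := congrArg (fun t ↦ mvfderiv (coneModel I) f p (horVec p (basePart p w)) • t) h4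
    simp only [smul_add] at h6
    simp only [add_apply, smul_apply, smul_eq_mul]
    linear_combination (norm := module) -h6

lemma exists_isConeConnection [T2Space M] [I.Boundaryless] (hlam : lam ≠ 0) :
    ∃ nabla : AffineConnection (coneModel I) (Cone M), IsConeConnection gM D c lam nabla := by
  have hh : ∀ p : Cone M, lam * height p ≠ 0 := fun p ↦ mul_ne_zero hlam (height_pos p).ne'
  have h1 : ∀ (X : Π x : M, TangentSpace I x) (q : Cone M), dsPart q (lift X q) = 0 :=
    fun _ _ ↦ dsPart_horVec _
  have h2 : ∀ (X : Π x : M, TangentSpace I x) s, slicePart s (lift X) = X := fun X s ↦ by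
    ext x; exact basePart_horVec (p := (x, s)) (X x)
  have h3 : ∀ s, slicePart s (radialField (I := I) (M := M) lam) = 0 := fun s ↦ by
    ext x; exact basePart_radialField (p := (x, s))
  have h4 : (fun q : Cone M ↦ dsPart q (radialField (I := I) lam q) / (lam * height q))
      = fun _ ↦ 1 := by
    ext q; rw [dsPart_radialField, div_self (hh q)]
  refine ⟨⟨coneNabla lam c gM D, isCovariantDerivativeOn_coneNabla hlam⟩,
    fun p v Y hY ↦ ?_, fun p v ↦ ?_, fun p X hX ↦ ?_, fun p ↦ ?_⟩
  · refine (coneNabla_apply _).trans ?_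
    simp only [h1, h2, zero_div, mvfderiv_const, basePart_horVec, dsPart_horVec]
    rw [gM.symm, HessianCone.lift, basePart_horVec]
    simp [sub_eq_add_neg]
  · refine (coneNabla_apply _).trans ?_
    rw [h4, h3, dsPart_radialField, div_self (hh p)]
    simp [mvfderiv_const, basePart_horVec, dsPart_horVec, basePart_radialField]
  · refine (coneNabla_apply _).trans ?_
    simp only [h1, h2, zero_div, mvfderiv_const, basePart_radialField, dsPart_radialField,
      mlieBracket_radialField_lift _ hX, smul_smul, mul_inv_cancel₀ (hh p)]
    simp
  · refine (coneNabla_apply _).trans ?_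
    rw [h4, h3]
    simp [mvfderiv_const, basePart_radialField, dsPart_radialField, smul_smul]
    rw [← mul_inv_rev, mul_inv_cancel₀ (hh p), one_smul]

end Connection
end ConeMetric

/-! ### From a Hessian cone to a statistical structure on M -/

section LinkConnection
variable {E : Type*} [NormedAddCommGroup E] [NormedSpace ℝ E]
  {H : Type*} [TopologicalSpace H] {I : ModelWithCorners ℝ E H}
  {M : Type*} [TopologicalSpace M] [ChartedSpace H M] [IsManifold I ∞ M]
  {F : Type*} [NormedAddCommGroup F] [NormedSpace ℝ F]
  {X Y Z : Π x : M, TangentSpace I x} {p : Cone M} {lam c : ℝ}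
  {gM : SmoothMetric I M} {D : AffineConnection I M}
  {nabla : AffineConnection (coneModel I) (Cone M)} {g : SmoothMetric (coneModel I) (Cone M)}
  {σ τ : Π p : Cone M, TangentSpace (coneModel I) p}
open VectorField Filter Topology

lemma eq_of_mfderiv_posReal_eq_zero {f : PosReal → F}
    (hf : MDifferentiable 𝓘(ℝ) 𝓘(ℝ, F) f) (h : ∀ s, mvfderiv 𝓘(ℝ) f s = 0) (s t : PosReal) :
    f s = f t := by
  let e := extChartAt 𝓘(ℝ) s
  have het : ∀ r ∈ Set.Ioi (0 : ℝ), r ∈ e.target := by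
    intro r hr
    have := (extChartAt 𝓘(ℝ) (⟨r, hr⟩ : PosReal)).map_source (mem_extChartAt_source _)
    exact this
  have hes : ∀ u : PosReal, e.symm (u : ℝ) = u := fun u ↦
    (extChartAt 𝓘(ℝ) u).left_inv (mem_extChartAt_source _)
  have hd : ∀ r ∈ Set.Ioi (0 : ℝ), HasFDerivAt (f ∘ e.symm) (0 : ℝ →L[ℝ] F) r := by
    intro r hr
    have h1 : MDifferentiableAt 𝓘(ℝ) 𝓘(ℝ) e.symm r :=
      ((contMDiffOn_extChartAt_symm (n := ∞) s).contMDiffAt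
        (mem_of_superset (Ioi_mem_nhds hr) het)).mdifferentiableAt (by simp)
    have h2 := HasMFDerivAt.comp r (hf (e.symm r)).hasMFDerivAt h1.hasMFDerivAt
    have h3 : mfderiv 𝓘(ℝ) 𝓘(ℝ, F) f (e.symm r) = 0 := h _
    rw [h3] at h2
    exact (hasMFDerivAt_iff_hasFDerivAt.1 h2).congr_fderiv (by ext; rfl)
  have hc := (convex_Ioi (0 : ℝ)).is_const_of_fderivWithin_eq_zero (𝕜 := ℝ) (f := f ∘ e.symm)
    (fun r hr ↦ (hd r hr).differentiableAt.differentiableWithinAt)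
    (fun r hr ↦ by
      rw [fderivWithin_of_isOpen isOpen_Ioi hr, (hd r hr).fderiv]) s.2 t.2
  simpa [hes] using hc

section
variable [CompleteSpace E] [I.Boundaryless]

/-- Both sides lie in T_x M. In the chart at x, commuting with ρ says that ρ annihilates the base
components of σ, as ρ annihilates the coordinates of M; hence they are constant along the ray over
x. -/
lemma basePart_eq_of_mlieBracket_radialField_eq_zero (hlam : lam ≠ 0) (hσ : SmoothField σ)
    (h : ∀ p, mlieBracket (coneModel I) (radialField lam) σ p = 0) (x : M) (s t : PosReal) :
    basePart (x, s) (σ (x, s)) = basePart (x, t) (σ (x, t)) := by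
  let G : Cone M → E := fun q ↦ mvfderiv I (extChartAt I x) q.1 (basePart q (σ q))
  let φ : Cone M → E := fun q ↦ extChartAt I x q.1
  have hf : ContMDiffAt I 𝓘(ℝ, E) ∞ (extChartAt I x) x := contMDiffAt_extChartAt
  have hφ : ∀ s : PosReal, ContMDiffAt (coneModel I) 𝓘(ℝ, E) ∞ φ (x, s) := fun s ↦
    ContMDiffAt.comp (x, s) hf contMDiffAt_fst
  have hev : ∀ (ρ : Π p : Cone M, TangentSpace (coneModel I) p) (s : PosReal), ∀ᶠ q in 𝓝 (x, s),
      mvfderiv (coneModel I) φ q (ρ q) = mvfderiv I (extChartAt I x) q.1 (basePart q (ρ q)) := by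
    intro ρ s
    have : ∀ᶠ q : Cone M in 𝓝 (x, s), MDifferentiableAt I 𝓘(ℝ, E) (extChartAt I x) q.1 := by
      refine continuousAt_fst.eventually (p := fun x' ↦ MDifferentiableAt I 𝓘(ℝ, E) _ x') ?_
      filter_upwards [extChartAt_source_mem_nhds (I := I) x] with x' hx'
      exact mdifferentiableAt_extChartAt (by simpa using hx')
    filter_upwards [this] with q hq
    exact mvfderiv_comp_fst hq _
  have hG : ∀ s : PosReal, MDifferentiableAt (coneModel I) 𝓘(ℝ, E) G (x, s) := fun s ↦
    (mdifferentiableAt_mvfderiv_apply (hφ s) (by norm_cast) (hσ.diffFieldAt _)).congr_of_eventuallyEq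
      ((hev σ s).mono fun q hq ↦ hq.symm)
  have hGρ : ∀ s : PosReal, mvfderiv (coneModel I) G (x, s) (radialField lam (x, s)) = 0 := fun s ↦ by
    have h1 := mvfderiv_mlieBracket (hφ s)
      ((smoothField_radialField (I := I) lam).diffFieldAt (x, s)) (hσ.diffFieldAt (x, s))
    have h2 : (fun q ↦ mvfderiv (coneModel I) φ q (radialField lam q)) =ᶠ[𝓝 (x, s)] fun _ ↦ 0 :=
      (hev (radialField lam) s).mono fun q hq ↦ by
        simp only [hq, basePart_radialField, map_zero]
    rw [h, map_zero, mvfderiv_congr (hev σ s), mvfderiv_congr h2, mvfderiv_const] at h1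
    rw [zero_apply, sub_zero] at h1
    exact h1.symm
  have hslice : ∀ s : PosReal, MDifferentiableAt 𝓘(ℝ) (coneModel I)
      (fun s : PosReal ↦ ((x, s) : Cone M)) s := fun s ↦
    mdifferentiableAt_const.prodMk mdifferentiableAt_id
  have key := eq_of_mfderiv_posReal_eq_zero (f := fun s ↦ G (x, s))
    (fun s ↦ MDifferentiableAt.comp s (hG s) (hslice s)) (fun s ↦ ?_) s t
  · have hid : mfderiv I 𝓘(ℝ, E) (extChartAt I x) x = ContinuousLinearMap.id ℝ E :=
      mfderiv_extChartAt_self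
    simp only [G, mvfderiv, hid] at key
    exact key
  · refine ContinuousLinearMap.ext fun a ↦ ?_
    have h1 := mfderiv_comp_apply s (hG s) (hslice s) a
    refine h1.trans ?_
    obtain ⟨b, hb⟩ : ∃ b : ℝ, b = a := ⟨a, rfl⟩
    have h2 : mfderiv 𝓘(ℝ) (coneModel I) (fun s : PosReal ↦ ((x, s) : Cone M)) s a
        = (b / (lam * height ((x, s) : Cone M))) • radialField (I := I) lam (x, s) := by
      rw [mfderiv_prod_right]
      have := height_pos ((x, s) : Cone M)
      apply cone_ext
      · rw [basePart_smul, basePart_radialField, smul_zero, basePart_eq]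
        rfl
      · rw [dsPart_smul, dsPart_radialField, div_mul_cancel₀ _ (mul_ne_zero hlam this.ne'), dsPart_eq]
        exact hb.symm
    rw [h2]
    refine (map_smul (mvfderiv (coneModel I) G (x, s)) _ _).trans ?_
    rw [hGρ, smul_zero]
    rfl

end

/-- The point `1` of the half-line. -/
def oneHeight : PosReal := ⟨1, Set.mem_Ioi.2 one_pos⟩

/-- The connection on `M` induced by a connection on the cone along `M × {1}`. -/
def linkConnection (nabla : AffineConnection (coneModel I) (Cone M)) : AffineConnection I M where
  toFun Y x := basePartL (x, oneHeight) ∘L nabla (lift Y) (x, oneHeight) ∘L horVecL (x, oneHeight)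
  isCovariantDerivativeOnUniv :=
    { add := fun {Y Y' x} hY hY' _ ↦ by
        have h1 : lift (I := I) (Y + Y') = lift Y + lift Y' := by ext q : 1; exact horVec_add _ _
        have hl : DiffFieldAt (lift (I := I) Y) (x, oneHeight) := DiffFieldAt.lift hY
        have hl' : DiffFieldAt (lift (I := I) Y') (x, oneHeight) := DiffFieldAt.lift hY'
        ext v : 1
        simp only [ContinuousLinearMap.comp_apply, add_apply, h1, nabla_add hl hl', map_add]
      leibniz := fun {Y f x} hY hf _ ↦ by
        have h1 : lift (I := I) (f • Y) = (fun q : Cone M ↦ f q.1) • lift Y := by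
          ext q : 1; exact horVec_smul _ _
        have hl : DiffFieldAt (lift (I := I) Y) (x, oneHeight) := DiffFieldAt.lift hY
        have hf' : MDifferentiableAt (coneModel I) 𝓘(ℝ) (fun q : Cone M ↦ f q.1) (x, oneHeight) :=
          MDifferentiableAt.comp (x, oneHeight) hf mdifferentiableAt_fst
        have h2 : ∀ v, mvfderiv (coneModel I) (fun q : Cone M ↦ f q.1) (x, oneHeight)
            (horVecL (x, oneHeight) v) = mvfderiv I f x v := fun v ↦ by
          rw [mvfderiv_comp_fst hf, horVecL_apply, basePart_horVec]
        have h3 : basePartL (x, oneHeight) (lift Y (x, oneHeight)) = Y x := basePart_horVec _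
        ext v : 1
        simp only [ContinuousLinearMap.comp_apply, add_apply, h1, nabla_smul hl hf', map_add, h2,
          map_smul, h3]
        rfl }

lemma linkConnection_apply (Y : Π x : M, TangentSpace I x) (x : M) (v : TangentSpace I x) :
    linkConnection nabla Y x v
      = basePart (x, oneHeight) (nabla (lift Y) (x, oneHeight) (horVec (x, oneHeight) v)) := rfl

lemma IsTorsionFree.apply [FiniteDimensional ℝ E] [T2Space M] {nabla : AffineConnection I M}
    (h : IsTorsionFree nabla) {x : M} (hX : DiffFieldAt X x) (hY : DiffFieldAt Y x) :
    nabla Y x (X x) - nabla X x (Y x) = mlieBracket I X Y x := by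
  obtain ⟨X', hX', hXx⟩ := exists_smoothField_eq (X x)
  obtain ⟨Y', hY', hYx⟩ := exists_smoothField_eq (Y x)
  rw [← sub_eq_zero, ← nabla.torsion_apply hX hY, ← hXx, ← hYx,
    nabla.torsion_apply (hX'.diffFieldAt x) (hY'.diffFieldAt x), h X' Y' hX' hY', sub_self]

/-- For λ = 0 the radial field is zero, so ∇ρ = 0 is not the identity. A point is needed because
over an empty M the condition is vacuous. -/
lemma IsRadiant.ne_zero (hr : IsRadiant nabla (radialField lam)) (p : Cone M) : lam ≠ 0 := by
  rintro rfl
  have h0 : (radialField 0 : Π p : Cone M, TangentSpace (coneModel I) p)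
      = (0 : ℝ) • radialField 1 := by
    ext q : 1
    exact cone_ext (by simp [basePart_radialField])
      (by simp [dsPart_radialField])
  have h1 := hr.nabla_rho p (radialField 1 p)
  rw [h0, nabla_const_smul 0 ((smoothField_radialField (I := I) 1).diffFieldAt p), zero_smul] at h1
  have h2 := congrArg (dsPart p) h1
  rw [dsPart_radialField, dsPart_zero, one_mul] at h2
  exact (height_pos p).ne h2

section Cone
variable [FiniteDimensional ℝ E] [T2Space M] [I.Boundaryless]

lemma IsRadiant.nabla_lift_radialField (hr : IsRadiant nabla (radialField lam))
    (hX : DiffFieldAt X p.1) : nabla (lift X) p (radialField lam p) = lift X p := by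
  have h := hr.flat_affine.torsion_free.apply (hr.smooth_field.diffFieldAt p) hX.lift
  rwa [mlieBracket_radialField_lift _ hX, hr.nabla_rho, sub_eq_zero] at h

/-- Flatness on ρ, X, Y with [ρ, X] = 0 and ∇_ρ Y = Y gives ∇_ρ ∇_X Y = ∇_X Y. The latter is also
the derivative of ρ along ∇_X Y, so torsion-freeness makes the bracket vanish. -/
lemma IsRadiant.mlieBracket_radialField_nabla_lift (hr : IsRadiant nabla (radialField lam))
    (hX : SmoothField X) (hY : SmoothField Y) :
    mlieBracket (coneModel I) (radialField lam) (fun q ↦ nabla (lift Y) q (lift X q)) p = 0 := by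
  have hs := smoothField_nabla hr.flat_affine.smooth hY.lift hX.lift
  have h1 := hr.flat_affine.flat _ _ _ hr.smooth_field hX.lift hY.lift p
  have h2 : (fun q ↦ nabla (lift Y) q (radialField lam q)) = lift Y := by
    ext q : 1
    exact hr.nabla_lift_radialField (hY.diffFieldAt _)
  rw [curvature, h2, mlieBracket_radialField_lift _ (hX.diffFieldAt _), map_zero, sub_zero] at h1
  rw [← hr.flat_affine.torsion_free _ _ hr.smooth_field hs, hr.nabla_rho, h1]

lemma metric_lift_lift (hg : IsConeMetric gM g) (X Y : Π x : M, TangentSpace I x) (q : Cone M) :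
    g.inner q (lift X q) (lift Y q) = height q ^ 2 * gM.inner q.1 (X q.1) (Y q.1) := by
  rw [hg, lift, lift, basePart_horVec, basePart_horVec, dsPart_horVec, zero_mul, add_zero]
  rfl

lemma metric_radialField (hg : IsConeMetric gM g) (w : TangentSpace (coneModel I) p) :
    g.inner p (radialField lam p) w = lam * height p * dsPart p w := by
  rw [hg, basePart_radialField, dsPart_radialField]
  simp

lemma mvfderiv_metric_lift_lift (hg : IsConeMetric gM g) (hX : SmoothField X) (hY : SmoothField Y)
    (w : TangentSpace (coneModel I) p) :
    mvfderiv (coneModel I) (fun q ↦ g.inner q (lift X q) (lift Y q)) p w =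
      height p ^ 2 * mvfderiv I (fun x ↦ gM.inner x (X x) (Y x)) p.1 (basePart p w)
      + 2 * height p * dsPart p w * gM.inner p.1 (X p.1) (Y p.1) := by
  have h1 : (fun q ↦ g.inner q (lift X q) (lift Y q)) = fun q : Cone M ↦
      (1 * (height q * height q)) * gM.inner q.1 (X q.1) (Y q.1) := by
    ext q; rw [metric_lift_lift hg]; ring
  have h2 := (contMDiff_height (I := I) p).mdifferentiableAt (by simp)
  have h3 : MDifferentiableAt (coneModel I) 𝓘(ℝ) (fun q : Cone M ↦ 1 * (height q * height q)) p :=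
    mdifferentiableAt_const.mul (h2.mul h2)
  have h4 := mdifferentiableAt_metric_apply gM (hX.diffFieldAt p.1) (hY.diffFieldAt p.1)
  have h5 : MDifferentiableAt (coneModel I) 𝓘(ℝ)
      (fun q : Cone M ↦ gM.inner q.1 (X q.1) (Y q.1)) p := h4.comp p mdifferentiableAt_fst
  rw [h1, mvfderiv_fun_mul h3 h5]
  simp only [add_apply, smul_apply, smul_eq_mul, mvfderiv_height_sq, mvfderiv_comp_fst h4]
  ring

/-- This is the Codazzi equation for X, ρ, Y: since g(ρ, Y) = 0 and ρ(g(X, Y)) = 2λ g(X, Y), it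
yields g(ρ, ∇_X Y) = (1 - 2λ) g(X, Y). -/
lemma IsHessianCone.dsPart_nabla_lift (h : IsHessianCone gM nabla g)
    (hr : IsRadiant nabla (radialField lam)) (hX : SmoothField X) (hY : SmoothField Y) :
    dsPart p (nabla (lift Y) p (lift X p))
      = -((2 * lam - 1) / lam ^ 2 * gM.inner p.1 (X p.1) (Y p.1)) * (lam * height p) := by
  have hlam := hr.ne_zero p
  have hp := (height_pos p).ne'
  have h1 := h.hessian.covDerivMetric_swap hX.lift hr.smooth_field hY.lift p
  have h0 : (fun q ↦ g.inner q (radialField lam q) (lift Y q)) = fun _ ↦ 0 := by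
    ext q
    rw [metric_radialField h.cone_metric, lift, dsPart_horVec, mul_zero]
  rw [covDerivMetric, covDerivMetric, h0, mvfderiv_metric_lift_lift h.cone_metric hX hY] at h1
  simp only [mvfderiv_const, hr.nabla_rho, hr.nabla_lift_radialField (hX.diffFieldAt _),
    hr.nabla_lift_radialField (hY.diffFieldAt _), metric_lift_lift h.cone_metric,
    metric_radialField h.cone_metric, basePart_radialField, dsPart_radialField, map_zero,
    zero_apply] at h1
  have h2 : lam * dsPart p (nabla (lift Y) p (lift X p)) =
      (1 - 2 * lam) * height p * gM.inner p.1 (X p.1) (Y p.1) :=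
    mul_left_cancel₀ hp (by linarith)
  field_simp
  linarith

lemma IsHessianCone.isConeConnection (h : IsHessianCone gM nabla g)
    (hr : IsRadiant nabla (radialField lam)) :
    IsConeConnection gM (linkConnection nabla) ((2 * lam - 1) / lam ^ 2) lam nabla where
  gauss p v Y hY := by
    have hlam := hr.ne_zero p
    obtain ⟨X, hX, hXv⟩ := exists_smoothField_eq v
    obtain ⟨Y', hY', hYY'⟩ := exists_smoothField_eq (Y p.1)
    set D := linkConnection nabla
    set c := (2 * lam - 1) / lam ^ 2
    -- Both sides of the Gauss formula obey the same Leibniz rule in Y, so their difference is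
    -- tensorial and the merely differentiable Y may be replaced by a smooth field with the same
    -- value.
    have hT : TensorialAt I E (fun Y ↦ nabla (lift Y) p (horVec p v) - (horVec p (D Y p.1 v)
        - (c * gM.inner p.1 v (Y p.1)) • radialField lam p)) p.1 :=
      { smul := fun {f Y} hf hY ↦ by
          have h1 : lift (I := I) (f • Y) = (fun q : Cone M ↦ f q.1) • lift Y := by
            ext q : 1; exact horVec_smul _ _
          have hl : DiffFieldAt (lift (I := I) Y) p := DiffFieldAt.lift hY
          have hf' : MDifferentiableAt (coneModel I) 𝓘(ℝ) (fun q : Cone M ↦ f q.1) p :=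
            hf.comp p mdifferentiableAt_fst
          rw [h1, nabla_smul hl hf', nabla_smul hY hf, mvfderiv_comp_fst hf, basePart_horVec,
            Pi.smul_apply', horVec_add, horVec_smul, horVec_smul, map_smul, smul_eq_mul, lift]
          module
        add := fun {Y Y'} hY hY' ↦ by
          have h1 : lift (I := I) (Y + Y') = lift Y + lift Y' := by ext q : 1; exact horVec_add _ _
          have hl : DiffFieldAt (lift (I := I) Y) p := DiffFieldAt.lift hY
          have hl' : DiffFieldAt (lift (I := I) Y') p := DiffFieldAt.lift hY'
          rw [h1, nabla_add hl hl', nabla_add hY hY', Pi.add_apply, horVec_add, map_add]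
          module }
    rw [← sub_eq_zero]
    refine (hT.pointwise hY (hY'.diffFieldAt p.1) hYY'.symm).trans ?_
    rw [sub_eq_zero]
    rw [← hXv]
    apply cone_ext
    · rw [basePart_sub, basePart_smul, basePart_radialField, smul_zero, sub_zero, basePart_horVec]
      exact basePart_eq_of_mlieBracket_radialField_eq_zero hlam
        (smoothField_nabla hr.flat_affine.smooth hY'.lift hX.lift)
        (fun q ↦ hr.mlieBracket_radialField_nabla_lift hX hY') p.1 p.2 oneHeight
    · refine (h.dsPart_nabla_lift hr hX hY').trans ?_
      rw [dsPart_sub, dsPart_smul, dsPart_radialField, dsPart_horVec]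
      ring
  hor_rho p v := hr.nabla_rho p _
  rho_hor p X hX := hr.nabla_lift_radialField hX
  rho_rho p := hr.nabla_rho p _

lemma contMDiff_linkConnection (hs : CovariantDerivative.ContMDiffCovariantDerivative nabla ∞) :
    CovariantDerivative.ContMDiffCovariantDerivative (linkConnection nabla) ∞ := by
  refine contMDiffCovariantDerivative_of_apply fun X Y x hX hY ↦ ?_
  have h1 : ContMDiffAt (coneModel I) (coneModel I).tangent ∞ (fun q : Cone M ↦
      (⟨q, lift Y q⟩ : TangentBundle (coneModel I) (Cone M))) (x, oneHeight) :=
    contMDiffAt_horVec (V := fun q ↦ Y q.1) le_rfl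
      (ContMDiffAt.comp (x, oneHeight) hY contMDiffAt_fst)
  have h2 := (contMDiff_nabla hs hX.lift (x, oneHeight)).clm_bundle_apply h1
  exact ContMDiffAt.comp (I' := coneModel I) (f := fun y : M ↦ ((y, oneHeight) : Cone M)) x
    (contMDiffAt_basePart h2) (contMDiffAt_id.prodMk contMDiffAt_const)

lemma IsTorsionFree.linkConnection (h : IsTorsionFree nabla) :
    IsTorsionFree (linkConnection nabla) := by
  intro X Y hX hY x
  have h1 := h _ _ hX.lift hY.lift (x, oneHeight)
  rw [mlieBracket_lift (hX.diffFieldAt _) (hY.diffFieldAt _)] at h1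
  rw [linkConnection_apply, linkConnection_apply, ← basePart_sub]
  refine (congrArg (basePart (x, oneHeight)) h1).trans ?_
  exact basePart_horVec _

lemma IsHessianCone.isStatistical (h : IsHessianCone gM nabla g) :
    IsStatistical (linkConnection nabla) gM where
  smooth := contMDiff_linkConnection h.hessian.flat_affine.smooth
  torsion_free := h.hessian.flat_affine.torsion_free.linkConnection
  symm_left X Y Z hX hY hZ x := by
    -- At s = 1 the metric g restricts to g_M on lifts, and the radial part of ∇_X Y is orthogonal
    -- to lifts, so D g_M is the restriction of ∇g.
    have key : ∀ {X Y Z : Π x : M, TangentSpace I x}, SmoothField X → SmoothField Y →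
        SmoothField Z → covDerivMetric (linkConnection nabla) gM X Y Z x
          = covDerivMetric nabla g (lift X) (lift Y) (lift Z) (x, oneHeight) := by
      intro X Y Z hX hY hZ
      have h1 : ∀ W : Π x : M, TangentSpace I x,
          basePart (x, oneHeight) (lift W (x, oneHeight)) = W x := fun W ↦ basePart_horVec _
      have h2 : ∀ W : Π x : M, TangentSpace I x,
          dsPart (x, oneHeight) (lift W (x, oneHeight)) = 0 := fun W ↦ dsPart_horVec _
      have h3 : height ((x, oneHeight) : Cone M) = 1 := rfl
      have h4 : ((oneHeight : PosReal) : ℝ) = 1 := rfl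
      rw [covDerivMetric, covDerivMetric, mvfderiv_metric_lift_lift h.cone_metric hY hZ,
        h.cone_metric, h.cone_metric, h1, h1, h1, h2, h2, h2, h3, h4]
      simp [linkConnection_apply]
      rfl
    rw [key hX hY hZ, key hY hX hZ, h.hessian.covDerivMetric_swap hX.lift hY.lift hZ.lift]
  symm_right X Y Z _ _ _ x := by
    have h1 : (fun y ↦ gM.inner y (Y y) (Z y)) = fun y ↦ gM.inner y (Z y) (Y y) := by
      ext y; exact gM.symm _ _ _
    rw [covDerivMetric, covDerivMetric, h1, gM.symm x _ (Z x), gM.symm x (Y x)]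
    ring

/-- The base part at s = 1 of the flatness equation on three lifts: the multiples of ρ drop out and
the terms -c g_M(Y, Z) X + c g_M(X, Z) Y remain beside the curvature of D. -/
lemma IsHessianCone.isStatisticalOfConstCurvature (h : IsHessianCone gM nabla g)
    (hr : IsRadiant nabla (radialField lam)) :
    IsStatisticalOfConstCurvature (linkConnection nabla) gM ((2 * lam - 1) / lam ^ 2) where
  statistical := h.isStatistical
  curvature_eq X Y Z hX hY hZ x := by
    have hc := h.isConeConnection hr
    have hs := h.isStatistical.smooth
    have hlam := hr.ne_zero (x, oneHeight)
    have h1 := h.hessian.flat_affine.flat _ _ _ hX.lift hY.lift hZ.lift (x, oneHeight)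
    have h2 : ∀ {W V : Π x : M, TangentSpace I x}, SmoothField W →
        basePart (x, oneHeight) (nabla (lift W) (x, oneHeight) (lift V (x, oneHeight)))
          = linkConnection nabla W x (V x) := fun _ ↦ rfl
    rw [curvature, hc.nabla_nabla_lift_lift hlam hs hY hZ, hc.nabla_nabla_lift_lift hlam hs hX hZ,
      mlieBracket_lift (hX.diffFieldAt _) (hY.diffFieldAt _)] at h1
    have h3 := congrArg (basePart (x, oneHeight)) h1
    have h4 : ∀ W : Π x : M, TangentSpace I x,
      basePart (x, oneHeight) (lift W (x, oneHeight)) = W x := fun W ↦ basePart_horVec _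
    simp only [basePart_sub, basePart_add, basePart_smul, basePart_radialField, h4, basePart_zero,
      smul_zero, h2 (smoothField_nabla hs hZ hY), h2 (smoothField_nabla hs hZ hX), h2 hZ] at h3
    rw [curvature]
    linear_combination (norm := module) h3

end Cone
end LinkConnection

/-! ### The radial constant and the theorem -/

lemma exists_radial_const {c : ℝ} (hc : c ≠ 0) (hc1 : c ≤ 1) :
    ∃ lam : ℝ, (2 * lam - 1) / lam ^ 2 = c := by
  have hr := Real.sqrt_nonneg (1 - c)
  have hr2 := Real.sq_sqrt (sub_nonneg.2 hc1)
  have h1 : 1 + √(1 - c) ≠ 0 := by positivity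
  -- A root of cλ² - 2λ + 1 = 0; the plus sign keeps it nonzero for every c ≤ 1.
  refine ⟨(1 + √(1 - c)) / c, ?_⟩
  rw [div_eq_iff (pow_ne_zero 2 (div_ne_zero h1 hc))]
  field_simp
  linear_combination -hr2

end HessianCone

end

theorem theorem2
    {E : Type*} [NormedAddCommGroup E] [NormedSpace ℝ E] [FiniteDimensional ℝ E]
    {H : Type*} [TopologicalSpace H] (I : ModelWithCorners ℝ E H) [I.Boundaryless]
    (M : Type*) [TopologicalSpace M] [T2Space M] [ChartedSpace H M] [IsManifold I ∞ M]
    (gM : SmoothMetric I M) :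
    (∀ (nabla : AffineConnection (coneModel I) (Cone M))
        (g : SmoothMetric (coneModel I) (Cone M)) (lam : ℝ),
      IsHessianCone gM nabla g →
      IsRadiant nabla (radialField lam) →
      ∃ D : AffineConnection I M,
        GaussFormula gM D ((2 * lam - 1) / lam ^ 2) lam nabla ∧
        IsStatisticalOfConstCurvature D gM ((2 * lam - 1) / lam ^ 2)) ∧
    (∀ (D : AffineConnection I M) (c : ℝ), c ≠ 0 → c ≤ 1 →
      IsStatisticalOfConstCurvature D gM c →
      (∃ lam : ℝ, (2 * lam - 1) / lam ^ 2 = c) ∧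
      ∀ lam : ℝ, (2 * lam - 1) / lam ^ 2 = c →
        (∃ g : SmoothMetric (coneModel I) (Cone M),
          IsConeMetric gM g) ∧
        (∃ nabla : AffineConnection (coneModel I) (Cone M),
          IsConeConnection gM D c lam nabla) ∧
        ∀ (nabla : AffineConnection (coneModel I) (Cone M))
          (g : SmoothMetric (coneModel I) (Cone M)),
          IsConeConnection gM D c lam nabla → IsConeMetric gM g →
          IsHessianCone gM nabla g ∧
          IsRadiant nabla (radialField lam)) := by
  refine ⟨fun nabla g lam h hr ↦ ⟨linkConnection nabla, (h.isConeConnection hr).gauss,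
    h.isStatisticalOfConstCurvature hr⟩, fun D c hc hc1 hD ↦ ⟨exists_radial_const hc hc1,
    fun lam hlc ↦ ?_⟩⟩
  -- Division by zero gives 0, so λ = 0 would satisfy the equation only for c = 0; λ = 1/2 also
  -- gives c = 0.
  have hlam : lam ≠ 0 := by
    rintro rfl
    exact hc (by simpa using hlc.symm)
  have hlam' : lam ≠ 1 / 2 := by
    rintro rfl
    exact hc (by simpa using hlc.symm)
  exact ⟨exists_isConeMetric gM, exists_isConeConnection hlam, fun nabla g h hg ↦
    ⟨h.isHessianCone hlam hlam' hlc hD hg, h.isRadiant hlam hD⟩⟩
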